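/- **Setting.** For $r,m\ge 0$ let $\mathrm{RM}(r,m)\subseteq\mathbb F_2^{2^m}$ be the Reed–Muller code of evaluation vectors of polynomials in $x_1,\dots,x_m$ of degree at most $r$; position $j$ corresponds to the point $\rho(j)=\mathrm{bin}(j-1)\in\mathbb F_2^m$. For $\frac{m-1}{2}\le r\le m$ put $$|0\rangle_{r,m}=\frac1{\sqrt{|\mathrm{RM}(r,m)^\perp|}}\sum_{c\in \mathrm{RM}(r,m)^\perp}|c\rangle ,$$ a state of $2^m$ qubits $q_1,\dots,q_{2^m}$. For distinct coordinates $s=(s_1,\dots,s_l)$ and $t\in\mathbb F_2^l$ let $Q(s;t)$ be the block of the $2^{m-l}$ qubits $q_j$ with $\rho(j)_{s_i}=t_i$ for all $i$, taken in increasing order. **Encoders.** Let $G(r,m)=\begin{bmatrix}G(r,m-1)&G(r,m-1)\\0&G(r-1,m-1)\end{bmatrix}$, with $G(r,m)$ empty for $r<0$ and $G(r,0)=[1]$ for $r\ge0$ (so $G(m,m)=\begin{bmatrix}1&1\\0&1\end{bmatrix}^{\otimes m}$); $A\setminus B$ denotes the rows of $A$ that are not rows of $B$, in their order. The encoder $U(r,m)$,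 $\frac{m-1}2\le r\le m$, and an index map $M_{r,m}$ from rows to qubit positions are defined recursively. For $r=m$, $M_{m,m}$ is the row index in $G(m,m)$; $U(0,0)=I$; and for $m\ge1$, $U(m,m)$ consists of, in order of application: a qubit permutation $p$ with $p(M_{m,m}(u,u))=M_{m-1,m-1}(u)$ and $p(M_{m,m}(0,u))=2^{m-1}+M_{m-1,m-1}(u)$ for all rows $u$ of $G(m-1,m-1)$; CNOTs from $M_{m-1,m-1}(u)$ to $2^{m-1}+M_{m-1,m-1}(u)$ for these $u$; and $U(m-1,m-1)^{\otimes2}$ on the two halves. For $r<m$, $M_{r,m}$ is the row index in the matrix with the rows of $G_1=G(r,m)\setminus G(m-r-1,m)$ followed by the rows $(u,u)$, $u\in G_2=G(m-r-1,m-1)\setminus G(m-r-2,m-1)$, and $U(r,m)$ consists of, in order of application: Hadamard gates on the qubits $M_{r,m}(u,u)$, $u\in G_2$; a qubit permutation $p$ with $p(M_{r,m}(u,u))=M_{r,m-1}(u)$ for $u\in G_3=G(r,m-1)\setminus G(m-r-2,m-1)$ and $p(M_{r,m}(0,v))=2^{m-1}+M_{r,m-1}(v)$ for $v\in G(r-1,m-1)\setminus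 G(m-r-2,m-1)$; CNOTs from $M_{r,m-1}(u)$ to $2^{m-1}+M_{r,m-1}(u)$ for $u\in G_3$; and $U(r,m-1)^{\otimes 2}$ on the two halves. Any permutations meeting these requirements may be used. **Statement.** Let $m\le 2r+1$. 1. Let $1\le l\le m-r$, let $s$ be a sequence of $l$ distinct coordinates, and let $U(r,m-l)$ be any encoder as above. Applying $U(r,m-l)^\dagger$ to each of the $2^l$ blocks $Q(s;t)$, $t\in\mathbb F_2^l$, of $|0\rangle_{r,m}$ gives a state in which at least $\binom{m-l}{m-r-1}$ GHZ states $\frac{1}{\sqrt2}(|0\cdots0\rangle+|1\cdots1\rangle)$ on $2^l$ qubits are shared among all the blocks: there are pairwise distinct qubits $q_{j,t}\in Q(s;t)$, $1\le j\le\binom{m-l}{m-r-1}$, $t\in\mathbb F_2^l$, such that the resulting state is the tensor product, over $j$, of the GHZ states on $\{q_{j,t}\}_{t}$ and a unit state of all the remaining qubits. 2. For $l=1$ (so $r<m$) and any coordinate $i$, these are Bell pairs across the bipartition: applying $U(r,m-1)^\dagger$ to $Q(i;0)$ and to $Q(i;1)$ turns $|0\rangle_{r,m}$ into the tensor product of $\binom{m-1}{m-r-1}$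 Bell pairs $\frac1{\sqrt2}(|00\rangle+|11\rangle)$, each with one qubit in $Q(i;0)$ and one in $Q(i;1)$, all on distinct qubits, and the state $|0\cdots0\rangle$ of the remaining qubits. -/

import Mathlib

open scoped Matrix

namespace QRM

/-! ### Bit strings, qubits and states -/

/-- The evaluation points of a length `2 ^ m` Reed-Muller code. The qubits are labelled by them:
the qubit in position `j` (counted from `0`) is labelled by `rho m j`. -/
abbrev Pt (m : ℕ) : Type := Fin m → ZMod 2

/-- The `m`-bit binary representation of `j`, most significant bit first. -/
def rho (m j : ℕ) : Pt m := fun i => if j.testBit (m - 1 - i) then 1 else 0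

/-- Binary words whose positions are labelled by `ι`. -/
abbrev Word (ι : Type*) : Type _ := ι → ZMod 2

/-- Pure states (amplitude functions) of a register of qubits labelled by `ι`. -/
abbrev State (ι : Type*) : Type _ := Word ι → ℂ

/-- Operators on a register of qubits labelled by `ι`, in the computational basis. -/
abbrev Op (ι : Type*) : Type _ := Matrix (Word ι) (Word ι) ℂ

variable {ι : Type*} [Fintype ι] [DecidableEq ι]

/-- The computational basis state of a word. -/
def ket (a : Word ι) : State ι := fun b => if b = a then 1 else 0

/-- Normalised states. -/
def IsUnitState (φ : State ι) : Prop := ∑ b, ‖φ b‖ ^ 2 = 1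

/-- The GHZ state `(|0…0⟩ + |1…1⟩) / √2`, with one qubit for every element of `ι`. -/
noncomputable def ghz : State ι := ((1 / Real.sqrt 2 : ℝ) : ℂ) • (ket 0 + ket 1)

/-- The Bell pair `(|00⟩ + |11⟩) / √2`. -/
noncomputable def bell : State (Fin 2) :=
  ((1 / Real.sqrt 2 : ℝ) : ℂ) • (ket ![0, 0] + ket ![1, 1])

/-- `ψ` is the tensor product of `N` copies of `χ`, the `j`-th copy sitting on the qubits
`q j t`, and of the state `φ` of all the remaining qubits. -/
def FactorsAs {κ : Type*} [Fintype κ] {N : ℕ} (ψ : State ι) (q : Fin N → κ → ι) (χ : State κ)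
    (φ : State {x : ι // ∀ j t, q j t ≠ x}) : Prop :=
  ∀ b : Word ι, ψ b = (∏ j, χ fun t => b (q j t)) * φ fun x => b x

/-! ### Gates -/

/-- The Hadamard gate on qubit `i`. -/
noncomputable def hadamardGate (i : ι) : Op ι := fun b' b =>
  if ∀ j, j ≠ i → b' j = b j then
    ((1 / Real.sqrt 2 : ℝ) : ℂ) * (if b' i = 1 ∧ b i = 1 then -1 else 1)
  else 0

/-- The CNOT gate with control `i` and target `j`. -/
def cnotGate (i j : ι) : Op ι := fun b' b =>
  if b' = Function.update b j (b j + b i) then 1 else 0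

/-- The permutation of qubits that moves the qubit `i` to `p i`. -/
def permGate (p : Equiv.Perm ι) : Op ι := fun b' b => if b' = fun i => b (p.symm i) then 1 else 0

/-! ### Reed-Muller codes and quantum Reed-Muller codewords -/

/-- `RM(r, m)`: the evaluation vectors of the polynomials of degree at most `r`. -/
noncomputable def RM (r m : ℕ) : Submodule (ZMod 2) (Word (Pt m)) :=
  (MvPolynomial.restrictTotalDegree (Fin m) (ZMod 2) r).map (MvPolynomial.evalₗ (ZMod 2) (Fin m))

open Classical in
/-- The words of the dual code of `RM(r, m)`. -/
noncomputable def RMdual (r m : ℕ) : Finset (Word (Pt m)) :=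
  Finset.univ.filter fun c => ∀ w ∈ RM r m, ∑ x, w x * c x = 0

/-- The codeword `|w⟩_{r,m}` of `QRM(r, m)`: the uniform superposition of the coset of `w`
modulo the dual of `RM(r, m)`. -/
noncomputable def codeword (r m : ℕ) (w : Word (Pt m)) : State (Pt m) :=
  ((1 / Real.sqrt ((RMdual r m).card : ℝ) : ℝ) : ℂ) • ∑ c ∈ RMdual r m, ket (w + c)

/-! ### Generator matrices -/

/-- The concatenation `(u, v)`; the first half of the positions has first bit `0`. -/
def pair {m : ℕ} (u v : Word (Pt m)) : Word (Pt (m + 1)) := fun x =>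
  if x 0 = 0 then u (Fin.tail x) else v (Fin.tail x)

/-- The list of rows of the generator matrix
`G(r, m) = [G(r, m-1) G(r, m-1); 0 G(r-1, m-1)]`. It is empty for `r < 0` and equal to
`[1 1; 0 1]^{⊗ m}` for `r ≥ m`. -/
def genRows : (m : ℕ) → ℤ → List (Word (Pt m))
  | 0, r => if r < 0 then [] else [fun _ => 1]
  | m + 1, r => (genRows m r).map (fun u => pair u u) ++ (genRows m (r - 1)).map (fun v => pair 0 v)

/-- The rows of the first matrix that are not rows of the second. -/
def rowsDiff {m : ℕ} (A B : List (Word (Pt m))) : List (Word (Pt m)) := A.filter (· ∉ B)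

/-- The ordered rows of the matrix behind the qubit index map of the recursive encoder of
`QRM(r, m)`: for `r = m` those of `G(m, m)`; for `r < m` first those of
`G₁ = G(r, m) \ G(m-r-1, m)` (the message), then those of `[G₂ | G₂]` with
`G₂ = G(m-r-1, m-1) \ G(m-r-2, m-1)`. -/
def encRows (r : ℕ) : (m : ℕ) → List (Word (Pt m))
  | 0 => genRows 0 r
  | m + 1 =>
    if r = m + 1 then genRows (m + 1) r
    else rowsDiff (genRows (m + 1) r) (genRows (m + 1) ((m : ℤ) - r)) ++
      (rowsDiff (genRows m ((m : ℤ) - r)) (genRows m ((m : ℤ) - r - 1))).map fun u => pair u u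

/-- The qubit index map `M`: the row `g` is sent to the qubit whose position is the row index
of `g`. -/
def rowQubit (r m : ℕ) (g : Word (Pt m)) : Pt m := rho m ((encRows r m).idxOf g)

/-! ### Recursive encoders -/

/-- The qubit `x` of the first half. -/
def lo {m : ℕ} (x : Pt m) : Pt (m + 1) := Fin.cons 0 x

/-- The qubit `x` of the second half. -/
def hi {m : ℕ} (x : Pt m) : Pt (m + 1) := Fin.cons 1 x

/-- `U ⊗ U`, acting on the two halves of the qubits. -/
def doubled {m : ℕ} (U : Op (Pt m)) : Op (Pt (m + 1)) := fun b' b =>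
  U (fun x => b' (lo x)) (fun x => b (lo x)) * U (fun x => b' (hi x)) (fun x => b (hi x))

/-- `U` is an output of the recursive construction of the computational basis encoder
`U(m, m) = U_{G(m, m)}`: a qubit permutation, then CNOT gates from the first to the second half,
then the encoders of the two halves. -/
inductive IsBasisEncoder : (m : ℕ) → Op (Pt m) → Prop
  | zero : IsBasisEncoder 0 1
  | succ (m : ℕ) (U : Op (Pt m)) (hU : IsBasisEncoder m U) (p : Equiv.Perm (Pt (m + 1)))
      (hlo : ∀ u ∈ genRows m m, p (rowQubit (m + 1) (m + 1) (pair u u)) = lo (rowQubit m m u))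
      (hhi : ∀ v ∈ genRows m m, p (rowQubit (m + 1) (m + 1) (pair 0 v)) = hi (rowQubit m m v)) :
      IsBasisEncoder (m + 1)
        (doubled U *
          ((genRows m m).map fun u => cnotGate (lo (rowQubit m m u)) (hi (rowQubit m m u))).prod *
          permGate p)

/-- `U` is an output `U(r, m)` of the recursive construction of the encoder of `QRM(r, m)`, for
`(m - 1) / 2 ≤ r ≤ m`. For `r = m` it is a computational basis encoder. Otherwise it consists of
Hadamard gates on the ancilla qubits that follow the message qubits (the ones that carry the
rows of `[G₂ | G₂]`), a qubit permutation, CNOT gates from the first to the second half, and the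
encoders `U(r, m-1)` of the two halves. The permutation is any one that meets the stated
requirements. -/
inductive IsEncoder (r : ℕ) : (m : ℕ) → Op (Pt m) → Prop
  | basis (U : Op (Pt r)) (hU : IsBasisEncoder r U) : IsEncoder r r U
  | step (m : ℕ) (hm : m + 1 ≤ 2 * r + 1) (U : Op (Pt m)) (hU : IsEncoder r m U)
      (p : Equiv.Perm (Pt (m + 1)))
      (hlo : ∀ u ∈ rowsDiff (genRows m r) (genRows m ((m : ℤ) - r - 1)),
        p (rowQubit r (m + 1) (pair u u)) = lo (rowQubit r m u))
      (hhi : ∀ v ∈ rowsDiff (genRows m ((r : ℤ) - 1)) (genRows m ((m : ℤ) - r - 1)),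
        p (rowQubit r (m + 1) (pair 0 v)) = hi (rowQubit r m v)) :
      IsEncoder r (m + 1)
        (doubled U *
          ((rowsDiff (genRows m r) (genRows m ((m : ℤ) - r - 1))).map fun u =>
            cnotGate (lo (rowQubit r m u)) (hi (rowQubit r m u))).prod *
          permGate p *
          ((rowsDiff (genRows m ((m : ℤ) - r)) (genRows m ((m : ℤ) - r - 1))).map fun u =>
            hadamardGate (rowQubit r (m + 1) (pair u u))).prod)

/-! ### The recursive construction can be carried out

At every stage the required values of the qubit permutation are consistent, so the encoder
`U(r, m)` exists for all `(m - 1) / 2 ≤ r ≤ m`. -/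

theorem pair_inj {m : ℕ} {u v u' v' : Word (Pt m)} (h : pair u v = pair u' v') :
    u = u' ∧ v = v' := by
  constructor
  · funext x
    simpa [pair] using congrFun h (Fin.cons 0 x)
  · funext x
    simpa [pair] using congrFun h (Fin.cons 1 x)

theorem rho_inj {m j k : ℕ} (hj : j < 2 ^ m) (hk : k < 2 ^ m) (h : rho m j = rho m k) :
    j = k := by
  apply Nat.eq_of_testBit_eq
  intro i
  by_cases hi : i < m
  · have := congrFun h ⟨m - 1 - i, by omega⟩
    have e : m - 1 - (m - 1 - i) = i := by omega
    simp only [rho, e] at this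
    cases h1 : j.testBit i <;> cases h2 : k.testBit i <;> simp_all
  · have hm : 2 ^ m ≤ 2 ^ i := Nat.pow_le_pow_right (by norm_num) (by omega)
    rw [Nat.testBit_lt_two_pow (by omega), Nat.testBit_lt_two_pow (by omega)]

theorem zero_notMem_genRows (m : ℕ) (r : ℤ) : (0 : Word (Pt m)) ∉ genRows m r := by
  induction m generalizing r with
  | zero =>
    unfold genRows
    split
    · simp
    · simp only [List.mem_singleton]
      intro h
      simpa using congrFun h 0
  | succ m ih =>
    have h0 : (0 : Word (Pt (m + 1))) = pair 0 0 := by funext x; simp [pair]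
    simp only [genRows, List.mem_append, List.mem_map, not_or, not_exists, not_and]
    refine ⟨fun u hu h => ih r ?_, fun v hv h => ih (r - 1) ?_⟩
    · exact (pair_inj (h.trans h0)).1 ▸ hu
    · exact (pair_inj (h.trans h0)).2 ▸ hv

theorem pair_self_mem {m : ℕ} {r : ℤ} {u : Word (Pt m)} :
    pair u u ∈ genRows (m + 1) r ↔ u ∈ genRows m r := by
  simp only [genRows, List.mem_append, List.mem_map]
  constructor
  · rintro (⟨v, hv, h⟩ | ⟨v, hv, h⟩)
    · exact (pair_inj h).1 ▸ hv
    · obtain ⟨h1, h2⟩ := pair_inj h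
      exact absurd (h2.trans h1.symm ▸ hv) (zero_notMem_genRows m _)
  · exact fun h => Or.inl ⟨u, h, rfl⟩

theorem pair_zero_mem {m : ℕ} {r : ℤ} {v : Word (Pt m)} :
    pair 0 v ∈ genRows (m + 1) r ↔ v ∈ genRows m (r - 1) := by
  simp only [genRows, List.mem_append, List.mem_map]
  constructor
  · rintro (⟨u, hu, h⟩ | ⟨u, hu, h⟩)
    · exact absurd ((pair_inj h).1 ▸ hu) (zero_notMem_genRows m _)
    · exact (pair_inj h).2 ▸ hu
  · exact fun h => Or.inr ⟨v, h, rfl⟩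

theorem genRows_nodup (m : ℕ) (r : ℤ) : (genRows m r).Nodup := by
  induction m generalizing r with
  | zero => unfold genRows; split <;> simp
  | succ m ih =>
    simp only [genRows]
    refine List.Nodup.append ((ih r).map fun a b h => (pair_inj h).1)
      ((ih (r - 1)).map fun a b h => (pair_inj h).2) ?_
    intro x hx hx'
    simp only [List.mem_map] at hx hx'
    obtain ⟨u, hu, rfl⟩ := hx
    obtain ⟨v, hv, h⟩ := hx'
    exact zero_notMem_genRows m _ ((pair_inj h).1 ▸ hu)

theorem genRows_length_le (m : ℕ) (r : ℤ) : (genRows m r).length ≤ 2 ^ m := by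
  induction m generalizing r with
  | zero => unfold genRows; split <;> simp
  | succ m ih =>
    have := ih r
    have := ih (r - 1)
    simp only [genRows, List.length_append, List.length_map, pow_succ]
    omega

theorem genRows_mono {m : ℕ} {r r' : ℤ} (h : r ≤ r') : genRows m r ⊆ genRows m r' := by
  induction m generalizing r r' with
  | zero =>
    unfold genRows
    split <;> split <;> simp
    omega
  | succ m ih =>
    intro x hx
    simp only [genRows, List.mem_append, List.mem_map] at hx ⊢
    rcases hx with ⟨u, hu, rfl⟩ | ⟨u, hu, rfl⟩
    · exact Or.inl ⟨u, ih h hu, rfl⟩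
    · exact Or.inr ⟨u, ih (by omega) hu, rfl⟩

theorem genRows_stable {m : ℕ} {r : ℤ} (h : (m : ℤ) ≤ r) : genRows m r = genRows m m := by
  induction m generalizing r with
  | zero => unfold genRows; simp; omega
  | succ m ih =>
    push_cast at h ⊢
    have h1 : (m : ℤ) + 1 - 1 = m := by ring
    simp only [genRows, h1]
    rw [ih (r := r) (by omega), ih (r := r - 1) (by omega), ih (r := (m : ℤ) + 1) (by omega)]

theorem mem_rowsDiff {m : ℕ} {A B : List (Word (Pt m))} {x : Word (Pt m)} :
    x ∈ rowsDiff A B ↔ x ∈ A ∧ x ∉ B := by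
  simp [rowsDiff]

theorem encRows_self (m : ℕ) : encRows m m = genRows m m := by
  cases m <;> simp [encRows]

theorem encRows_length_le {r m : ℕ} (h2 : m ≤ 2 * r + 1) : (encRows r m).length ≤ 2 ^ m := by
  cases m with
  | zero => exact genRows_length_le 0 r
  | succ m =>
    rw [encRows]
    split
    · exact genRows_length_le _ _
    · refine le_trans (List.Subperm.length_le (List.Nodup.subperm ?_ ?_))
        (genRows_length_le (m + 1) r)
      · refine List.Nodup.append ((genRows_nodup _ _).filter _)
          (((genRows_nodup _ _).filter _).map fun a b h => (pair_inj h).1) ?_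
        intro x hx hx'
        obtain ⟨u, hu, rfl⟩ := List.mem_map.1 hx'
        exact (mem_rowsDiff.1 hx).2 (pair_self_mem.2 (mem_rowsDiff.1 hu).1)
      · intro x hx
        rcases List.mem_append.1 hx with hx | hx
        · exact (mem_rowsDiff.1 hx).1
        · obtain ⟨u, hu, rfl⟩ := List.mem_map.1 hx
          exact pair_self_mem.2 (genRows_mono (by omega) (mem_rowsDiff.1 hu).1)

theorem rowQubit_inj {r m : ℕ} (h2 : m ≤ 2 * r + 1) {g g' : Word (Pt m)}
    (hg : g ∈ encRows r m) (hg' : g' ∈ encRows r m) (h : rowQubit r m g = rowQubit r m g') :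
    g = g' := by
  have l1 := List.idxOf_lt_length_of_mem hg
  have l2 := List.idxOf_lt_length_of_mem hg'
  have l3 := encRows_length_le h2
  exact (List.idxOf_inj hg).1 (rho_inj (by omega) (by omega) h)

theorem lohi_inj {m : ℕ} {a b : ZMod 2} {x y : Pt m}
    (h : (Fin.cons a x : Pt (m + 1)) = Fin.cons b y) : a = b ∧ x = y :=
  Fin.cons_inj.1 h

/-- A qubit permutation with the required values exists. -/
theorem exists_perm {m : ℕ} (A B : List (Word (Pt m))) (M : Word (Pt (m + 1)) → Pt (m + 1))
    (M₁ : Word (Pt m) → Pt m)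
    (hA : ∀ u ∈ A, u ≠ 0)
    (hM : ∀ g g', ((∃ u ∈ A, g = pair u u) ∨ ∃ v ∈ B, g = pair 0 v) →
      ((∃ u ∈ A, g' = pair u u) ∨ ∃ v ∈ B, g' = pair 0 v) → M g = M g' → g = g')
    (hM₁ : ∀ u v, (u ∈ A ∨ u ∈ B) → (v ∈ A ∨ v ∈ B) → M₁ u = M₁ v → u = v) :
    ∃ p : Equiv.Perm (Pt (m + 1)), (∀ u ∈ A, p (M (pair u u)) = lo (M₁ u)) ∧
      ∀ v ∈ B, p (M (pair 0 v)) = hi (M₁ v) := by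
  classical
  let a : {u // u ∈ A} ⊕ {v // v ∈ B} → Word (Pt (m + 1)) :=
    Sum.elim (fun u => pair u.1 u.1) fun v => pair 0 v.1
  let f : {u // u ∈ A} ⊕ {v // v ∈ B} → Pt (m + 1) :=
    Sum.elim (fun u => lo (M₁ u.1)) fun v => hi (M₁ v.1)
  have hmem : ∀ i, (∃ u ∈ A, a i = pair u u) ∨ ∃ v ∈ B, a i = pair 0 v := by
    rintro (u | v)
    · exact Or.inl ⟨u.1, u.2, rfl⟩
    · exact Or.inr ⟨v.1, v.2, rfl⟩
  have ha : Function.Injective fun i => M (a i) := by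
    intro i j h
    have h' := hM _ _ (hmem i) (hmem j) h
    rcases i with u | u <;> rcases j with v | v
    · exact congrArg Sum.inl (Subtype.ext (pair_inj h').1)
    · exact absurd (pair_inj h').1 (hA _ u.2)
    · exact absurd (pair_inj h').1.symm (hA _ v.2)
    · exact congrArg Sum.inr (Subtype.ext (pair_inj h').2)
  have hf : Function.Injective f := by
    intro i j h
    rcases i with u | u <;> rcases j with v | v
    · exact congrArg Sum.inl (Subtype.ext (hM₁ _ _ (Or.inl u.2) (Or.inl v.2) (lohi_inj h).2))
    · exact absurd (lohi_inj (a := 0) (b := 1) h).1 (by decide)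
    · exact absurd (lohi_inj (a := 1) (b := 0) h).1 (by decide)
    · exact congrArg Sum.inr (Subtype.ext (hM₁ _ _ (Or.inr u.2) (Or.inr v.2) (lohi_inj h).2))
  let e := (Equiv.ofInjective _ ha).symm.trans (Equiv.ofInjective _ hf)
  have key : ∀ i, e.extendSubtype (M (a i)) = f i := by
    intro i
    have hi : M (a i) ∈ Set.range fun i => M (a i) := ⟨i, rfl⟩
    rw [Equiv.extendSubtype_apply_of_mem e _ hi]
    have : (⟨M (a i), hi⟩ : Set.range fun i => M (a i)) = Equiv.ofInjective _ ha i := rfl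
    change (Equiv.ofInjective f hf ((Equiv.ofInjective _ ha).symm ⟨M (a i), hi⟩)).1 = f i
    rw [this, Equiv.symm_apply_apply]
    rfl
  exact ⟨e.extendSubtype, fun u hu => key (Sum.inl ⟨u, hu⟩), fun v hv => key (Sum.inr ⟨v, hv⟩)⟩

theorem exists_isBasisEncoder (m : ℕ) : ∃ U, IsBasisEncoder m U := by
  induction m with
  | zero => exact ⟨1, .zero⟩
  | succ m ih =>
    obtain ⟨U, hU⟩ := ih
    have c : (((m + 1 : ℕ) : ℤ) - 1) = m := by push_cast; ring
    have hrow : ∀ g, ((∃ u ∈ genRows m (m : ℤ), g = pair u u) ∨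
        ∃ v ∈ genRows m (m : ℤ), g = pair 0 v) → g ∈ encRows (m + 1) (m + 1) := by
      rw [encRows_self]
      rintro _ (⟨u, hu, rfl⟩ | ⟨v, hv, rfl⟩)
      · exact pair_self_mem.2 (genRows_mono (by push_cast; omega) hu)
      · exact pair_zero_mem.2 (by rwa [c])
    obtain ⟨p, h1, h2⟩ := exists_perm (genRows m m) (genRows m m) (rowQubit (m + 1) (m + 1))
      (rowQubit m m) (fun u hu h => zero_notMem_genRows m _ (h ▸ hu))
      (fun g g' hg hg' h => rowQubit_inj (by omega) (hrow g hg) (hrow g' hg') h)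
      (fun u v hu hv h => rowQubit_inj (by omega) (by rw [encRows_self]; tauto)
        (by rw [encRows_self]; tauto) h)
    exact ⟨_, .succ m U hU p h1 h2⟩

/-- The recursive construction can be carried out: an encoder `U(r, m)` exists. -/
theorem exists_isEncoder {r m : ℕ} (h1 : r ≤ m) (h2 : m ≤ 2 * r + 1) : ∃ U, IsEncoder r m U := by
  induction m, h1 using Nat.le_induction with
  | base =>
    obtain ⟨U, hU⟩ := exists_isBasisEncoder r
    exact ⟨U, .basis U hU⟩
  | succ m hrm ih =>
    obtain ⟨U, hU⟩ := ih (by omega)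
    have hne : ¬ r = m + 1 := by omega
    have hsmall : ∀ u, u ∈ rowsDiff (genRows m r) (genRows m ((m : ℤ) - r - 1)) ∨
        u ∈ rowsDiff (genRows m ((r : ℤ) - 1)) (genRows m ((m : ℤ) - r - 1)) →
        u ∈ encRows r m := by
      intro u hu
      have hu' : u ∈ genRows m r ∧ u ∉ genRows m ((m : ℤ) - r - 1) := by
        rcases hu with hu | hu
        · exact mem_rowsDiff.1 hu
        · exact ⟨genRows_mono (by omega) (mem_rowsDiff.1 hu).1, (mem_rowsDiff.1 hu).2⟩
      rcases Nat.eq_or_lt_of_le hrm with rfl | hlt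
      · rw [encRows_self]; exact hu'.1
      · obtain ⟨k, rfl⟩ : ∃ k, m = k + 1 := ⟨m - 1, by omega⟩
        rw [encRows]
        rw [if_neg (by omega)]
        refine List.mem_append_left _ (mem_rowsDiff.2 ⟨hu'.1, ?_⟩)
        have : (((k + 1 : ℕ) : ℤ) - r - 1) = (k : ℤ) - r := by push_cast; ring
        rw [← this]
        exact hu'.2
    have hrow : ∀ g,
        ((∃ u ∈ rowsDiff (genRows m r) (genRows m ((m : ℤ) - r - 1)), g = pair u u) ∨
        ∃ v ∈ rowsDiff (genRows m ((r : ℤ) - 1)) (genRows m ((m : ℤ) - r - 1)), g = pair 0 v) →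
        g ∈ encRows r (m + 1) := by
      intro g hg
      rw [encRows]
      rw [if_neg hne]
      rcases hg with ⟨u, hu, rfl⟩ | ⟨v, hv, rfl⟩
      · rw [mem_rowsDiff] at hu
        by_cases hu2 : u ∈ genRows m ((m : ℤ) - r)
        · exact List.mem_append_right _ (List.mem_map.2 ⟨u, mem_rowsDiff.2 ⟨hu2, hu.2⟩, rfl⟩)
        · exact List.mem_append_left _
            (mem_rowsDiff.2 ⟨pair_self_mem.2 hu.1, fun h => hu2 (pair_self_mem.1 h)⟩)
      · rw [mem_rowsDiff] at hv
        exact List.mem_append_left _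
          (mem_rowsDiff.2 ⟨pair_zero_mem.2 hv.1, fun h => hv.2 (pair_zero_mem.1 h)⟩)
    obtain ⟨p, hp1, hp2⟩ := exists_perm
      (rowsDiff (genRows m r) (genRows m ((m : ℤ) - r - 1)))
      (rowsDiff (genRows m ((r : ℤ) - 1)) (genRows m ((m : ℤ) - r - 1)))
      (rowQubit r (m + 1)) (rowQubit r m)
      (fun u hu h => zero_notMem_genRows m _ (h ▸ (mem_rowsDiff.1 hu).1))
      (fun g g' hg hg' h => rowQubit_inj h2 (hrow g hg) (hrow g' hg') h)
      (fun u v hu hv h => rowQubit_inj (by omega) (hsmall u hu) (hsmall v hv) h)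
    exact ⟨_, .step m h2 U hU p hp1 hp2⟩

/-! ### Blocks of qubits -/

/-- The block `Q(s; t)`: the qubits whose label has bit `t a` at the coordinate `s a`. -/
def block {l m : ℕ} (s : Fin l ↪ Fin m) (t : Pt l) : Set (Pt m) := {x | ∀ a, x (s a) = t a}

theorem card_compl_coords {l m : ℕ} (s : Fin l ↪ Fin m) :
    ((Finset.univ.map s)ᶜ).card = m - l := by
  simp [Finset.card_compl]

/-- The qubit of the block `Q(s; t)` in the local position `x`: its bits at the coordinates
outside `s`, in increasing order of the coordinates, are those of `x`. Enumerating `x` in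
increasing binary order enumerates the block in increasing order. -/
noncomputable def blockQubit {l m : ℕ} (s : Fin l ↪ Fin m) (t : Pt l) (x : Pt (m - l)) : Pt m :=
  Function.extend s t
    (Function.extend ((Finset.univ.map s)ᶜ.orderEmbOfFin (card_compl_coords s)) x 0)

/-- The operator that applies `U` to each of the `2 ^ l` blocks `Q(s; t)`. -/
noncomputable def onBlocks {l m : ℕ} (s : Fin l ↪ Fin m) (U : Op (Pt (m - l))) : Op (Pt m) :=
  fun b' b => ∏ t : Pt l, U (fun x => b' (blockQubit s t x)) (fun x => b (blockQubit s t x))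

/-- The result of applying the decoder `U†` to each block `Q(s; t)` of the state `ψ`. -/
noncomputable def decodeBlocks {l m : ℕ} (s : Fin l ↪ Fin m) (U : Op (Pt (m - l)))
    (ψ : State (Pt m)) : State (Pt m) := onBlocks s Uᴴ *ᵥ ψ

end QRM

namespace QRM

/-! ### Monomials and their coefficients -/

/-- The evaluation vector of the monomial with exponent vector `a`. -/
def mono {m : ℕ} (a : Pt m) : Word (Pt m) := fun x => ∏ i, x i ^ (a i).val

/-- The Hamming weight, which is the degree of the monomial `mono a`. -/
def wt {m : ℕ} (a : Pt m) : ℕ := ∑ i, (a i).val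

/-- The coefficients of a word in the basis of monomials. -/
def coef {m : ℕ} (f : Word (Pt m)) : Word (Pt m) := fun a => ∑ x, mono x a * f x

theorem sum_mono_mul_mono {m : ℕ} (a b : Pt m) :
    ∑ x, mono x a * mono b x = if a = b then 1 else 0 := by
  have h : ∀ y z : ZMod 2, ∑ x : ZMod 2, y ^ x.val * x ^ z.val = if y = z then 1 else 0 := by
    decide
  simp only [mono, ← Finset.prod_mul_distrib]
  rw [← Fintype.prod_sum (fun i (x : ZMod 2) => a i ^ x.val * x ^ (b i).val)]
  simp only [h, funext_iff]
  by_cases hab : ∀ i, a i = b i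
  · simp [hab]
  · rw [if_neg hab]
    push Not at hab
    obtain ⟨i, hi⟩ := hab
    exact Finset.prod_eq_zero (Finset.mem_univ i) (if_neg hi)

theorem coef_mono {m : ℕ} (a b : Pt m) : coef (mono b) a = if a = b then 1 else 0 :=
  sum_mono_mul_mono a b

theorem coef_coef {m : ℕ} (f : Word (Pt m)) : coef (coef f) = f := by
  funext a
  simp only [coef, Finset.mul_sum]
  rw [Finset.sum_comm]
  simp only [← mul_assoc, ← Finset.sum_mul, sum_mono_mul_mono]
  simp

theorem eq_sum_coef {m : ℕ} (f : Word (Pt m)) (x : Pt m) : f x = ∑ a, mono a x * coef f a :=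
  (congrFun (coef_coef f) x).symm

theorem coef_add {m : ℕ} (f g : Word (Pt m)) : coef (f + g) = coef f + coef g := by
  funext a
  simp [coef, mul_add, Finset.sum_add_distrib]

theorem coef_zero {m : ℕ} : coef (0 : Word (Pt m)) = 0 := by
  funext a
  simp [coef]

theorem mono_injective {m : ℕ} : Function.Injective (mono (m := m)) := by
  intro a b h
  have h1 := coef_mono a b
  rw [← h, coef_mono, if_pos rfl] at h1
  by_contra hab
  simp [hab] at h1

/-! ### Splitting off the first coordinate -/

theorem lo_or_hi {m : ℕ} (x : Pt (m + 1)) : (∃ y, x = lo y) ∨ ∃ y, x = hi y := by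
  have h : ∀ z : ZMod 2, z = 0 ∨ z = 1 := by decide
  rcases h (x 0) with h | h
  · exact Or.inl ⟨Fin.tail x, by rw [lo, ← h, Fin.cons_self_tail]⟩
  · exact Or.inr ⟨Fin.tail x, by rw [hi, ← h, Fin.cons_self_tail]⟩

theorem lo_injective {m : ℕ} : Function.Injective (lo (m := m)) := fun _ _ h => (lohi_inj h).2

theorem hi_injective {m : ℕ} : Function.Injective (hi (m := m)) := fun _ _ h => (lohi_inj h).2

theorem lo_ne_hi {m : ℕ} (x y : Pt m) : lo x ≠ hi y := fun h => by
  simpa using (lohi_inj h).1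

theorem sum_lo_add_sum_hi {m : ℕ} {β : Type*} [AddCommMonoid β] (f : Pt (m + 1) → β) :
    ∑ x, f x = ∑ x, f (lo x) + ∑ x, f (hi x) := by
  rw [← (Fin.consEquiv fun _ => ZMod 2).sum_comp, Fintype.sum_prod_type]
  exact Fin.sum_univ_two _

theorem wt_lo {m : ℕ} (a : Pt m) : wt (lo a) = wt a := by
  simp [wt, lo, Fin.sum_univ_succ]

theorem wt_hi {m : ℕ} (a : Pt m) : wt (hi a) = wt a + 1 := by
  simp [wt, hi, Fin.sum_univ_succ, ZMod.val_one, add_comm]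

theorem wt_le {m : ℕ} (a : Pt m) : wt a ≤ m := by
  refine (Finset.sum_le_card_nsmul _ _ 1 fun i _ => ?_).trans (by simp)
  exact Nat.le_of_lt_succ (ZMod.val_lt (a i))

theorem mono_lo {m : ℕ} (a : Pt m) : mono (lo a) = pair (mono a) (mono a) := by
  funext x
  simp [mono, lo, pair, Fin.prod_univ_succ, Fin.tail]

theorem mono_hi {m : ℕ} (a : Pt m) : mono (hi a) = pair 0 (mono a) := by
  funext x
  have h : ∀ z : ZMod 2, z = 0 ∨ z = 1 := by decide
  rcases h (x 0) with h | h <;>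
    simp [mono, hi, pair, Fin.prod_univ_succ, Fin.tail, h, ZMod.val_one]

theorem mono_lo_lo {m : ℕ} (a x : Pt m) : mono (lo a) (lo x) = mono a x := by
  rw [mono_lo]
  simp [pair, lo]

theorem mono_lo_hi {m : ℕ} (a x : Pt m) : mono (lo a) (hi x) = mono a x := by
  simp [mono_lo, pair, hi]

theorem mono_hi_lo {m : ℕ} (a x : Pt m) : mono (hi a) (lo x) = 0 := by
  simp [mono_hi, pair, lo]

theorem mono_hi_hi {m : ℕ} (a x : Pt m) : mono (hi a) (hi x) = mono a x := by
  rw [mono_hi]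
  simp [pair, hi]

theorem coef_lo {m : ℕ} (f : Word (Pt (m + 1))) (a : Pt m) :
    coef f (lo a) = coef (fun x => f (lo x)) a := by
  simp [coef, sum_lo_add_sum_hi, mono_lo_lo, mono_hi_lo]

theorem coef_hi {m : ℕ} (f : Word (Pt (m + 1))) (a : Pt m) :
    coef f (hi a) = coef (fun x => f (lo x)) a + coef (fun x => f (hi x)) a := by
  simp [coef, sum_lo_add_sum_hi, mono_lo_hi, mono_hi_hi]

theorem mem_genRows {m : ℕ} {r : ℤ} {g : Word (Pt m)} :
    g ∈ genRows m r ↔ ∃ a, (wt a : ℤ) ≤ r ∧ mono a = g := by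
  induction m generalizing r with
  | zero =>
    have h1 : ∀ a : Pt 0, mono a = fun _ => 1 := fun a => by funext x; simp [mono]
    have h2 : ∀ a : Pt 0, wt a = 0 := fun a => by simp [wt]
    simp only [genRows, h1, h2]
    by_cases h : r < 0
    · simp [h]
    · simp only [h, if_false, List.mem_singleton, exists_const]
      constructor
      · exact fun hg => ⟨by push_cast; omega, hg.symm⟩
      · exact fun hg => hg.2.symm
  | succ m ih =>
    simp only [genRows, List.mem_append, List.mem_map, ih]
    constructor
    · rintro (⟨_, ⟨a, ha, rfl⟩, rfl⟩ | ⟨_, ⟨a, ha, rfl⟩, rfl⟩)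
      · exact ⟨lo a, by rwa [wt_lo], mono_lo a⟩
      · exact ⟨hi a, by rw [wt_hi]; push_cast; omega, mono_hi a⟩
    · rintro ⟨a, ha, rfl⟩
      rcases lo_or_hi a with ⟨u, rfl⟩ | ⟨u, rfl⟩
      · exact Or.inl ⟨_, ⟨u, by rwa [wt_lo] at ha, rfl⟩, (mono_lo u).symm⟩
      · exact Or.inr ⟨_, ⟨u, by rw [wt_hi] at ha; push_cast at ha; omega, rfl⟩, (mono_hi u).symm⟩

theorem mono_mem_genRows {m : ℕ} {r : ℤ} {a : Pt m} : mono a ∈ genRows m r ↔ (wt a : ℤ) ≤ r := by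
  rw [mem_genRows]
  constructor
  · rintro ⟨b, hb, h⟩
    rwa [← mono_injective h]
  · exact fun h => ⟨a, h, rfl⟩

theorem mono_mem_rowsDiff {m : ℕ} {r r' : ℤ} {a : Pt m} :
    mono a ∈ rowsDiff (genRows m r) (genRows m r') ↔ (wt a : ℤ) ≤ r ∧ r' < wt a := by
  rw [mem_rowsDiff, mono_mem_genRows, mono_mem_genRows, not_le]

/-! ### The dual of a Reed-Muller code -/

theorem sum_mono_mul_mono_eq_zero {m : ℕ} {a b : Pt m} (h : wt a + wt b < m) :
    ∑ x, mono a x * mono b x = 0 := by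
  have hk : ∀ y z : ZMod 2, y.val + z.val = 0 → ∑ x : ZMod 2, x ^ y.val * x ^ z.val = 0 := by
    decide
  simp only [mono, ← Finset.prod_mul_distrib]
  rw [← Fintype.prod_sum (fun i (x : ZMod 2) => x ^ (a i).val * x ^ (b i).val)]
  obtain ⟨i, hi⟩ : ∃ i, (a i).val + (b i).val = 0 := by
    by_contra! hne
    have : m ≤ wt a + wt b := by
      rw [wt, wt, ← Finset.sum_add_distrib]
      calc m = ∑ i : Fin m, 1 := by simp
        _ ≤ _ := Finset.sum_le_sum fun i _ => Nat.one_le_iff_ne_zero.2 (hne i)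
    omega
  exact Finset.prod_eq_zero (Finset.mem_univ i) (hk _ _ hi)

theorem mono_swap_mem_RM {r m : ℕ} {a : Pt m} (h : m ≤ r + wt a) :
    (fun x => mono x a) ∈ RM r m := by
  classical
  refine ⟨∏ i, if a i = 0 then 1 + MvPolynomial.X i else 1, ?_, ?_⟩
  · rw [SetLike.mem_coe, MvPolynomial.mem_restrictTotalDegree]
    refine (MvPolynomial.totalDegree_finsetProd _ _).trans ?_
    have h1 : ∀ i, (if a i = 0 then 1 + MvPolynomial.X i else 1 :
        MvPolynomial (Fin m) (ZMod 2)).totalDegree + (a i).val ≤ 1 := by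
      intro i
      have hz : ∀ z : ZMod 2, z ≠ 0 → z.val = 1 := by decide
      split_ifs with hi
      · rw [hi, ZMod.val_zero, add_zero]
        refine (MvPolynomial.totalDegree_add _ _).trans ?_
        simp
      · simp [hz _ hi]
    have h2 := Finset.sum_le_sum fun i (_ : i ∈ Finset.univ) => h1 i
    rw [Finset.sum_add_distrib] at h2
    simp only [Finset.sum_const, Finset.card_univ, Fintype.card_fin, smul_eq_mul, mul_one] at h2
    change _ + wt a ≤ m at h2
    omega
  · funext x
    have hz : ∀ y z : ZMod 2, (if y = 0 then 1 + z else 1) = y ^ z.val := by decide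
    simp only [MvPolynomial.evalₗ_apply, map_prod, mono]
    refine Finset.prod_congr rfl fun i _ => ?_
    rw [← hz]
    split_ifs <;> simp

theorem mem_RMdual {r m : ℕ} {c : Word (Pt m)} :
    c ∈ RMdual r m ↔ ∀ a, m ≤ r + wt a → coef c a = 0 := by
  simp only [RMdual, Finset.mem_filter, Finset.mem_univ, true_and]
  constructor
  · exact fun h a ha => h _ (mono_swap_mem_RM ha)
  · rintro h _ ⟨p, hp, rfl⟩
    rw [SetLike.mem_coe, MvPolynomial.mem_restrictTotalDegree] at hp
    simp only [MvPolynomial.evalₗ_apply, MvPolynomial.eval_eq', Finset.sum_mul]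
    rw [Finset.sum_comm]
    refine Finset.sum_eq_zero fun α hα => ?_
    let a : Pt m := fun i => if α i = 0 then 0 else 1
    have hpow : ∀ x : Pt m, ∏ i, x i ^ α i = mono a x := by
      intro x
      refine Finset.prod_congr rfl fun i _ => ?_
      have hz : ∀ z : ZMod 2, z = 0 ∨ z = 1 := by decide
      by_cases hi : α i = 0
      · simp [a, hi]
      · rcases hz (x i) with h | h <;> simp [a, hi, h, ZMod.val_one]
    have hwt : wt a ≤ r := by
      refine le_trans ?_ ((MvPolynomial.le_totalDegree hα).trans hp)
      rw [Finsupp.sum_fintype _ _ (by simp)]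
      refine Finset.sum_le_sum fun i _ => ?_
      by_cases hi : α i = 0
      · simp [a, hi]
      · simpa [a, hi, ZMod.val_one] using Nat.one_le_iff_ne_zero.2 hi
    simp only [hpow, mul_assoc, ← Finset.mul_sum]
    refine mul_eq_zero_of_right _ ?_
    calc ∑ x, mono a x * c x = ∑ x, ∑ b, mono a x * (mono b x * coef c b) := by
          simp only [← Finset.mul_sum, ← eq_sum_coef]
      _ = ∑ b, (∑ x, mono a x * mono b x) * coef c b := by
          rw [Finset.sum_comm]; simp only [Finset.sum_mul, mul_assoc]
      _ = 0 := by
          refine Finset.sum_eq_zero fun b _ => ?_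
          by_cases hb : m ≤ r + wt b
          · rw [h b hb, mul_zero]
          · rw [sum_mono_mul_mono_eq_zero (by omega), zero_mul]

/-! ### Blocks -/

section Blocks

variable {l m : ℕ} (s : Fin l ↪ Fin m)

theorem blockQubit_coord (t : Pt l) (x : Pt (m - l)) (a : Fin l) :
    blockQubit s t x (s a) = t a :=
  s.injective.extend_apply _ _ _

/-- The coordinates outside `s`, in increasing order. -/
noncomputable def complCoord : Fin (m - l) ↪o Fin m :=
  (Finset.univ.map s)ᶜ.orderEmbOfFin (card_compl_coords s)

theorem complCoord_ne (b : Fin (m - l)) (a : Fin l) : s a ≠ complCoord s b := by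
  intro h
  have := Finset.orderEmbOfFin_mem (Finset.univ.map s)ᶜ (card_compl_coords s) b
  rw [Finset.mem_compl] at this
  exact this (Finset.mem_map.2 ⟨a, Finset.mem_univ _, h⟩)

theorem blockQubit_complCoord (t : Pt l) (x : Pt (m - l)) (b : Fin (m - l)) :
    blockQubit s t x (complCoord s b) = x b := by
  rw [blockQubit, Function.extend_apply' _ _ _ fun ⟨a, ha⟩ => complCoord_ne s b a ha]
  exact (complCoord s).injective.extend_apply _ _ _

theorem coord_bijective :
    Function.Bijective (Sum.elim s (complCoord s) : Fin l ⊕ Fin (m - l) → Fin m) := by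
  have hl : l ≤ m := by simpa using Fintype.card_le_of_embedding s
  rw [Fintype.bijective_iff_injective_and_card]
  refine ⟨?_, by simp; omega⟩
  rintro (a | a) (b | b) h
  · exact congrArg _ (s.injective h)
  · exact absurd h (complCoord_ne s b a)
  · exact absurd h.symm (complCoord_ne s a b)
  · exact congrArg _ ((complCoord s).injective h)

theorem prod_coord {β : Type*} [CommMonoid β] (f : Fin m → β) :
    ∏ i, f i = (∏ a, f (s a)) * ∏ b, f (complCoord s b) := by
  rw [← (Equiv.ofBijective _ (coord_bijective s)).prod_comp, Fintype.prod_sum_type]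
  rfl

theorem mono_blockQubit (t' t : Pt l) (y' y : Pt (m - l)) :
    mono (blockQubit s t' y') (blockQubit s t y) = mono t' t * mono y' y := by
  simp only [mono, prod_coord s, blockQubit_coord, blockQubit_complCoord]

theorem wt_blockQubit (t : Pt l) (y : Pt (m - l)) : wt (blockQubit s t y) = wt t + wt y := by
  have := prod_coord s fun i => Multiplicative.ofAdd (blockQubit s t y i).val
  simpa only [wt, blockQubit_coord, blockQubit_complCoord, ← ofAdd_sum, ← ofAdd_add,
    EmbeddingLike.apply_eq_iff_eq] using this

/-- Every qubit lies in exactly one block, in exactly one local position. -/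
noncomputable def blockEquiv : Pt l × Pt (m - l) ≃ Pt m where
  toFun z := blockQubit s z.1 z.2
  invFun x := (fun a => x (s a), fun b => x (complCoord s b))
  left_inv z := by
    ext <;> simp [blockQubit_coord, blockQubit_complCoord]
  right_inv x := by
    funext i
    obtain ⟨a | b, rfl⟩ := (coord_bijective s).2 i
    · simp [blockQubit_coord]
    · simp [blockQubit_complCoord]

theorem sum_blockQubit {β : Type*} [AddCommMonoid β] (f : Pt m → β) :
    ∑ x, f x = ∑ t, ∑ y, f (blockQubit s t y) := by
  rw [← (blockEquiv s).sum_comp, Fintype.sum_prod_type]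
  rfl

theorem exists_blockQubit (x : Pt m) : ∃ t y, x = blockQubit s t y := by
  obtain ⟨z, rfl⟩ := (blockEquiv s).surjective x
  exact ⟨z.1, z.2, rfl⟩

theorem blockQubit_inj {t t' : Pt l} {y y' : Pt (m - l)}
    (h : blockQubit s t y = blockQubit s t' y') : t = t' ∧ y = y' :=
  Prod.ext_iff.1 ((blockEquiv s).injective (a₁ := (t, y)) (a₂ := (t', y')) h)

/-- The words on the blocks. -/
noncomputable def blockWords : Word (Pt m) ≃ (Pt l → Word (Pt (m - l))) :=
  ((blockEquiv s).symm.arrowCongr (Equiv.refl _)).trans (Equiv.curry _ _ _)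

theorem blockWords_apply (b : Word (Pt m)) (t : Pt l) (x : Pt (m - l)) :
    blockWords s b t x = b (blockQubit s t x) := rfl

theorem coef_blockWords (c : Word (Pt m)) (t : Pt l) (y : Pt (m - l)) :
    coef (blockWords s c t) y = ∑ t', mono t' t * coef c (blockQubit s t' y) := by
  have h : blockWords s c t =
      coef (fun y => ∑ t', mono t' t * coef c (blockQubit s t' y)) := by
    funext x
    rw [blockWords_apply, eq_sum_coef c, sum_blockQubit s, Finset.sum_comm]
    change _ = ∑ y', mono y' x * ∑ t', mono t' t * coef c (blockQubit s t' y')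
    simp only [Finset.mul_sum, mono_blockQubit, mul_assoc, mul_left_comm]
  rw [h, coef_coef]

theorem coef_blockQubit (c : Word (Pt m)) (t : Pt l) (y : Pt (m - l)) :
    coef c (blockQubit s t y) = ∑ t', mono t' t * coef (blockWords s c t') y := by
  have h : (fun t' => coef (blockWords s c t') y) =
      coef fun t' => coef c (blockQubit s t' y) := by
    funext t'
    exact coef_blockWords s c t' y
  change _ = coef (fun t' => coef (blockWords s c t') y) t
  rw [h, coef_coef]

end Blocks

/-! ### Gates that permute the computational basis -/

section Gates

set_option linter.unusedSectionVars false

variable {ι : Type*} [Fintype ι] [DecidableEq ι]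

/-- The operator that sends the basis state of `b` to the basis state of `f b`. -/
def wordGate (f : Word ι → Word ι) : Op ι := fun b' b => if b' = f b then 1 else 0

theorem mul_wordGate_apply (A : Op ι) (f : Word ι → Word ι) (b' b : Word ι) :
    (A * wordGate f) b' b = A b' (f b) := by
  simp [Matrix.mul_apply, wordGate]

theorem wordGate_mul (f g : Word ι → Word ι) : wordGate f * wordGate g = wordGate (f ∘ g) := by
  ext b' b
  rw [mul_wordGate_apply]
  rfl

theorem wordGate_id : wordGate (id : Word ι → Word ι) = 1 := by
  ext b' b
  simp [wordGate, Matrix.one_apply]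

theorem wordGate_isometry {f : Word ι → Word ι} (hf : Function.Injective f) :
    (wordGate f)ᴴ * wordGate f = 1 := by
  ext b' b
  rw [mul_wordGate_apply, Matrix.conjTranspose_apply, wordGate, Matrix.one_apply]
  simp [hf.eq_iff, eq_comm]

theorem permGate_eq (p : Equiv.Perm ι) : permGate p = wordGate fun b i => b (p.symm i) := rfl

theorem cnotGate_eq (i j : ι) :
    cnotGate i j = wordGate fun b => Function.update b j (b j + b i) := rfl

theorem permGate_isometry (p : Equiv.Perm ι) : (permGate p)ᴴ * permGate p = 1 := by
  refine wordGate_isometry fun a b h => ?_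
  funext i
  simpa using congrFun h (p i)

theorem cnotGate_isometry {i j : ι} (hij : i ≠ j) : (cnotGate i j)ᴴ * cnotGate i j = 1 := by
  refine wordGate_isometry fun a b h => ?_
  have hk : ∀ k, k ≠ j → a k = b k := fun k hk => by
    simpa [Function.update_of_ne hk] using congrFun h k
  funext k
  by_cases hkj : k = j
  · subst hkj
    simpa [hk i hij] using congrFun h k
  · exact hk k hkj

/-! ### Hadamard gates -/

theorem hadamardGate_update (i : ι) (a : Word ι) (z : ZMod 2) :
    hadamardGate i (Function.update a i z) a =
      ((1 / Real.sqrt 2 : ℝ) : ℂ) * (if z = 1 ∧ a i = 1 then -1 else 1) := by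
  rw [hadamardGate, if_pos fun j hj => Function.update_of_ne hj _ _, Function.update_self]

theorem inv_sqrt_two_mul_mul (y z : ℂ) :
    ((1 / Real.sqrt 2 : ℝ) : ℂ) * y * (((1 / Real.sqrt 2 : ℝ) : ℂ) * z) = 1 / 2 * (y * z) := by
  rw [mul_mul_mul_comm, ← Complex.ofReal_mul, ← sq, div_pow, Real.sq_sqrt (by norm_num)]
  norm_num

theorem hadamardGate_isometry (i : ι) : (hadamardGate i)ᴴ * hadamardGate i = 1 := by
  ext a b
  have hstar : ∀ k, star (hadamardGate i k a) = hadamardGate i k a := by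
    intro k
    simp only [hadamardGate]
    split_ifs <;> simp
  simp only [Matrix.mul_apply, Matrix.conjTranspose_apply, hstar]
  have hsum : ∑ k, hadamardGate i k a * hadamardGate i k b = ∑ z : ZMod 2,
      hadamardGate i (Function.update a i z) a * hadamardGate i (Function.update a i z) b := by
    refine (Finset.sum_of_injOn (fun z => Function.update a i z)
      (Function.update_injective a i).injOn (by simp) (fun k _ hk => ?_) fun _ _ => rfl).symm
    refine mul_eq_zero_of_left (if_neg fun h => hk ⟨k i, by simp, ?_⟩) _
    funext j
    by_cases hj : j = i
    · subst hj; simp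
    · simp [Function.update_of_ne hj, h j hj]
  have htwo : ∀ f : ZMod 2 → ℂ, ∑ z, f z = f 0 + f 1 := fun f => Fin.sum_univ_two f
  rw [hsum, htwo, Matrix.one_apply]
  by_cases hab : ∀ j, j ≠ i → a j = b j
  · have hb : ∀ z, Function.update a i z = Function.update b i z := by
      intro z
      funext j
      by_cases hj : j = i
      · subst hj; simp
      · simp [Function.update_of_ne hj, hab j hj]
    have heq : a = b ↔ a i = b i := by
      refine ⟨fun h => h ▸ rfl, fun h => ?_⟩
      funext j
      by_cases hj : j = i
      · exact hj ▸ h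
      · exact hab j hj
    have h1 : ∀ z, hadamardGate i (Function.update a i z) b =
      ((1 / Real.sqrt 2 : ℝ) : ℂ) * (if z = 1 ∧ b i = 1 then -1 else 1) := fun z => by
      rw [hb z, hadamardGate_update]
    have hz : ∀ z : ZMod 2, z = 0 ∨ z = 1 := by decide
    simp only [hadamardGate_update, h1, heq, inv_sqrt_two_mul_mul]
    rcases hz (a i) with h | h <;> rcases hz (b i) with h' | h' <;> simp [h, h'] <;> norm_num
  · have h0 : ∀ z, hadamardGate i (Function.update a i z) b = 0 := by
      refine fun z => if_neg fun h => hab fun j hj => ?_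
      simpa [Function.update_of_ne hj] using h j hj
    rw [if_neg fun h : a = b => hab fun j _ => congrFun h j]
    simp [h0]

/-- Hadamard gates on distinct qubits in the state `0` create a uniform superposition. -/
theorem hadamardGate_list_prod (L : List ι) (hL : L.Nodup) (b' b : Word ι)
    (hb : ∀ i ∈ L, b i = 0) :
    (L.map hadamardGate).prod b' b =
      if ∀ j, j ∉ L → b' j = b j then ((1 / Real.sqrt 2 : ℝ) : ℂ) ^ L.length else 0 := by
  induction L generalizing b' with
  | nil => simp [Matrix.one_apply, funext_iff]
  | cons i L ih =>
    rw [List.nodup_cons] at hL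
    simp only [List.map_cons, List.prod_cons, Matrix.mul_apply, List.length_cons]
    rw [Finset.sum_eq_single (Function.update b' i 0)]
    · have h1 : hadamardGate i b' (Function.update b' i 0) = ((1 / Real.sqrt 2 : ℝ) : ℂ) := by
        rw [hadamardGate, if_pos fun j hj => by simp [Function.update_of_ne hj]]
        simp
      rw [h1, ih hL.2 _ fun j hj => hb j (List.mem_cons_of_mem _ hj), mul_ite, mul_zero, pow_succ']
      refine if_congr ⟨fun h j hj => ?_, fun h j hj => ?_⟩ rfl rfl
      · rw [List.mem_cons, not_or] at hj
        simpa [Function.update_of_ne hj.1] using h j hj.2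
      · by_cases hji : j = i
        · subst hji; simp [hb j]
        · rw [Function.update_of_ne hji]
          exact h j (by simp [hji, hj])
    · intro k _ hk
      rw [ih hL.2 _ fun j hj => hb j (List.mem_cons_of_mem _ hj)]
      rw [mul_eq_zero, or_iff_not_imp_right]
      intro h
      rw [ite_eq_right_iff, Classical.not_imp] at h
      refine if_neg fun h' => hk ?_
      funext j
      by_cases hji : j = i
      · subst hji
        simpa [hb j] using h.1 j hL.1
      · rw [Function.update_of_ne hji, h' j hji]
    · simp

theorem list_prod_isometry (L : List (Op ι)) (hL : ∀ A ∈ L, Aᴴ * A = 1) :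
    L.prodᴴ * L.prod = 1 := by
  induction L with
  | nil => simp
  | cons A L ih =>
    rw [List.prod_cons, Matrix.conjTranspose_mul, Matrix.mul_assoc, ← Matrix.mul_assoc Aᴴ,
      hL A (by simp), Matrix.one_mul, ih fun B hB => hL B (by simp [hB])]

theorem mul_isometry {A B : Op ι} (hA : Aᴴ * A = 1) (hB : Bᴴ * B = 1) :
    (A * B)ᴴ * (A * B) = 1 := by
  rw [Matrix.conjTranspose_mul, Matrix.mul_assoc, ← Matrix.mul_assoc Aᴴ, hA, Matrix.one_mul, hB]

/-- A tensor power of an isometry is an isometry. -/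
theorem tensor_isometry {κ τ : Type*} [Fintype κ] [DecidableEq κ] [Fintype τ] [DecidableEq τ]
    (e : Word ι ≃ (τ → Word κ)) {U : Op κ} (hU : Uᴴ * U = 1) :
    (Matrix.of fun b' b => ∏ t, U (e b' t) (e b t) : Op ι)ᴴ *
      (Matrix.of fun b' b => ∏ t, U (e b' t) (e b t) : Op ι) = 1 := by
  ext a b
  simp only [Matrix.mul_apply, Matrix.conjTranspose_apply, Matrix.of_apply, star_prod,
    ← Finset.prod_mul_distrib]
  rw [e.sum_comp fun k => ∏ t, star (U (k t) (e a t)) * U (k t) (e b t),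
    ← Fintype.prod_sum fun t k => star (U k (e a t)) * U k (e b t)]
  have h : ∀ t, ∑ k, star (U k (e a t)) * U k (e b t) = if e a t = e b t then 1 else 0 := by
    intro t
    have := congrFun (congrFun hU (e a t)) (e b t)
    rwa [Matrix.mul_apply, Matrix.one_apply] at this
  simp only [h, Matrix.one_apply]
  by_cases hab : a = b
  · simp [hab]
  · obtain ⟨t, ht⟩ : ∃ t, e a t ≠ e b t := by
      by_contra! hne
      exact hab (e.injective (funext hne))
    rw [if_neg hab]
    exact Finset.prod_eq_zero (Finset.mem_univ t) (if_neg ht)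

end Gates

/-! ### CNOT gates between the two halves -/

/-- The action on words of CNOT gates from the first to the second half. -/
def cnotWord {m : ℕ} (L : List (Pt m)) (b : Word (Pt (m + 1))) : Word (Pt (m + 1)) := fun y =>
  if y 0 = 1 ∧ Fin.tail y ∈ L then b y + b (lo (Fin.tail y)) else b y

theorem cnotWord_lo {m : ℕ} (L : List (Pt m)) (b : Word (Pt (m + 1))) (x : Pt m) :
    cnotWord L b (lo x) = b (lo x) := by
  simp [cnotWord, lo]

theorem cnotWord_hi {m : ℕ} (L : List (Pt m)) (b : Word (Pt (m + 1))) (x : Pt m) :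
    cnotWord L b (hi x) = b (hi x) + if x ∈ L then b (lo x) else 0 := by
  by_cases h : x ∈ L <;> simp [cnotWord, hi, h]

theorem cnotGate_list_prod {m : ℕ} (L : List (Pt m)) (hL : L.Nodup) :
    (L.map fun x => cnotGate (lo x) (hi x)).prod = wordGate (cnotWord L) := by
  induction L with
  | nil =>
    rw [List.map_nil, List.prod_nil, ← wordGate_id]
    congr 1
    funext b y
    simp [cnotWord]
  | cons x L ih =>
    rw [List.nodup_cons] at hL
    rw [List.map_cons, List.prod_cons, ih hL.2, cnotGate_eq, wordGate_mul]
    congr 1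
    funext b y
    rcases lo_or_hi y with ⟨z, rfl⟩ | ⟨z, rfl⟩
    · simp [Function.update_of_ne (lo_ne_hi z x), cnotWord_lo]
    · by_cases hz : z = x
      · subst hz
        simp [cnotWord_lo, cnotWord_hi, hL.1]
      · simp [Function.update_of_ne (hi_injective.ne hz), cnotWord_hi, hz]

/-! ### Encoders are isometries -/

/-- The words on the two halves. -/
def halves (m : ℕ) : Word (Pt (m + 1)) ≃ (Fin 2 → Word (Pt m)) where
  toFun b := ![fun x => b (lo x), fun x => b (hi x)]
  invFun w := pair (w 0) (w 1)
  left_inv b := by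
    funext y
    rcases lo_or_hi y with ⟨z, rfl⟩ | ⟨z, rfl⟩ <;> simp [pair, lo, hi]
  right_inv w := by
    funext i x
    fin_cases i <;> simp [pair, lo, hi]

theorem doubled_isometry {m : ℕ} {U : Op (Pt m)} (hU : Uᴴ * U = 1) :
    (doubled U)ᴴ * doubled U = 1 := by
  have h : doubled U = Matrix.of fun b' b => ∏ t, U (halves m b' t) (halves m b t) := by
    ext b' b
    simp [doubled, halves, Fin.prod_univ_two]
  rw [h]
  exact tensor_isometry (halves m) hU

theorem cnotGate_map_prod_isometry {m : ℕ} {α : Type*} (L : List α) (M : α → Pt m) :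
    (L.map fun u => cnotGate (lo (M u)) (hi (M u))).prodᴴ *
      (L.map fun u => cnotGate (lo (M u)) (hi (M u))).prod = 1 := by
  refine list_prod_isometry _ fun A hA => ?_
  obtain ⟨u, -, rfl⟩ := List.mem_map.1 hA
  exact cnotGate_isometry (lo_ne_hi _ _)

theorem IsBasisEncoder.isometry {m : ℕ} {U : Op (Pt m)} (h : IsBasisEncoder m U) :
    Uᴴ * U = 1 := by
  induction h with
  | zero => simp
  | succ m U hU p hlo hhi ih =>
    exact mul_isometry (mul_isometry (doubled_isometry ih) (cnotGate_map_prod_isometry _ _))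
      (permGate_isometry p)

theorem IsEncoder.isometry {r m : ℕ} {U : Op (Pt m)} (h : IsEncoder r m U) : Uᴴ * U = 1 := by
  induction h with
  | basis U hU => exact hU.isometry
  | step m hm U hU p hlo hhi ih =>
    refine mul_isometry (mul_isometry (mul_isometry (doubled_isometry ih)
      (cnotGate_map_prod_isometry _ _)) (permGate_isometry p)) (list_prod_isometry _ fun A hA => ?_)
    obtain ⟨u, -, rfl⟩ := List.mem_map.1 hA
    exact hadamardGate_isometry _

theorem onBlocks_isometry {l m : ℕ} (s : Fin l ↪ Fin m) {U : Op (Pt (m - l))}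
    (hU : Uᴴ * U = 1) : (onBlocks s U)ᴴ * onBlocks s U = 1 :=
  tensor_isometry (blockWords s) hU

theorem onBlocks_conjTranspose {l m : ℕ} (s : Fin l ↪ Fin m) (U : Op (Pt (m - l))) :
    onBlocks s Uᴴ = (onBlocks s U)ᴴ := by
  ext b' b
  simp [onBlocks, Matrix.conjTranspose_apply]

/-! ### The message qubits -/

/-- The qubit that the index map assigns to the row `mono a`. -/
def monoQubit (r m : ℕ) (a : Pt m) : Pt m := rowQubit r m (mono a)

/-- The exponent vectors of the rows of `G(r, m) \ G(m-r-1, m)`. -/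
def IsMessage (r m : ℕ) (a : Pt m) : Prop := m ≤ r + wt a ∧ wt a ≤ r

instance (r m : ℕ) (a : Pt m) : Decidable (IsMessage r m a) := inferInstanceAs (Decidable (_ ∧ _))

/-- The word `b` vanishes outside the qubits `M a` with `P a`. -/
def SupportedOn {m : ℕ} (P : Pt m → Prop) (M : Pt m → Pt m) (b : Word (Pt m)) : Prop :=
  ∀ x, b x ≠ 0 → ∃ a, P a ∧ x = M a

theorem mono_mem_encRows {r m : ℕ} (h : r ≤ m) {a : Pt m} (ha : IsMessage r m a) :
    mono a ∈ encRows r m := by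
  obtain ⟨h1, h2⟩ := ha
  rcases Nat.eq_or_lt_of_le h with rfl | hlt
  · rw [encRows_self, mono_mem_genRows]
    omega
  · obtain ⟨k, rfl⟩ : ∃ k, m = k + 1 := ⟨m - 1, by omega⟩
    rw [encRows, if_neg (by omega)]
    refine List.mem_append_left _ (mono_mem_rowsDiff.2 ⟨?_, ?_⟩) <;> omega

theorem monoQubit_inj {r m : ℕ} (h1 : r ≤ m) (h2 : m ≤ 2 * r + 1) {a b : Pt m}
    (ha : IsMessage r m a) (hb : IsMessage r m b) (h : monoQubit r m a = monoQubit r m b) :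
    a = b :=
  mono_injective (rowQubit_inj h2 (mono_mem_encRows h1 ha) (mono_mem_encRows h1 hb) h)

theorem mem_rowsDiff_genRows {m : ℕ} {r r' : ℤ} {g : Word (Pt m)} :
    g ∈ rowsDiff (genRows m r) (genRows m r') ↔ ∃ a, ((wt a : ℤ) ≤ r ∧ r' < wt a) ∧ mono a = g := by
  constructor
  · intro h
    obtain ⟨a, -, rfl⟩ := mem_genRows.1 (mem_rowsDiff.1 h).1
    exact ⟨a, mono_mem_rowsDiff.1 h, rfl⟩
  · rintro ⟨a, h, rfl⟩
    exact mono_mem_rowsDiff.2 h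

/-! ### The recursive step -/

/-- What the qubit permutation and the CNOT gates do to a word. -/
theorem cnotWord_perm {m : ℕ} {G V : Pt m → Prop} {M' : Pt (m + 1) → Pt (m + 1)}
    {M : Pt m → Pt m} {p : Equiv.Perm (Pt (m + 1))} {L : List (Pt m)}
    (hL : ∀ x, x ∈ L ↔ ∃ u, G u ∧ M u = x)
    (hlo : ∀ u, G u → p (M' (lo u)) = lo (M u)) (hhi : ∀ v, V v → p (M' (hi v)) = hi (M v))
    (hV : ∀ v, V v → G v) (hM : ∀ u v, G u → G v → M u = M v → u = v)
    {k w : Word (Pt (m + 1))} (hw : w = cnotWord L fun i => k (p.symm i))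
    (hk : ∀ x, k x ≠ 0 → (∃ u, G u ∧ x = M' (lo u)) ∨ ∃ v, V v ∧ x = M' (hi v)) :
    SupportedOn G M (fun x => w (lo x)) ∧ SupportedOn G M (fun x => w (hi x)) ∧
      (∀ u, G u → w (lo (M u)) = k (M' (lo u))) ∧
      (∀ u, V u → w (hi (M u)) = k (M' (lo u)) + k (M' (hi u))) ∧
      ∀ u, G u → ¬ V u → w (hi (M u)) = k (M' (lo u)) := by
  have elo : ∀ u, G u → p.symm (lo (M u)) = M' (lo u) := fun u hu => by
    rw [← hlo u hu, Equiv.symm_apply_apply]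
  have ehi : ∀ v, V v → p.symm (hi (M v)) = M' (hi v) := fun v hv => by
    rw [← hhi v hv, Equiv.symm_apply_apply]
  have slo : ∀ y, k (p.symm (lo y)) ≠ 0 → ∃ u, G u ∧ y = M u := by
    intro y hy
    rcases hk _ hy with ⟨u, hu, h⟩ | ⟨v, hv, h⟩
    · rw [Equiv.symm_apply_eq, hlo u hu] at h
      exact ⟨u, hu, lo_injective h⟩
    · rw [Equiv.symm_apply_eq, hhi v hv] at h
      exact absurd h (lo_ne_hi _ _)
  have shi : ∀ y, k (p.symm (hi y)) ≠ 0 → ∃ v, V v ∧ y = M v := by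
    intro y hy
    rcases hk _ hy with ⟨u, hu, h⟩ | ⟨v, hv, h⟩
    · rw [Equiv.symm_apply_eq, hlo u hu] at h
      exact absurd h.symm (lo_ne_hi _ _)
    · rw [Equiv.symm_apply_eq, hhi v hv] at h
      exact ⟨v, hv, hi_injective h⟩
  have mL : ∀ u, G u → M u ∈ L := fun u hu => (hL _).2 ⟨u, hu, rfl⟩
  subst hw
  refine ⟨fun y hy => ?_, fun y hy => ?_, fun u hu => ?_, fun u hu => ?_, fun u hu hv => ?_⟩
  · simp only [cnotWord_lo] at hy
    exact slo y hy
  · simp only [cnotWord_hi] at hy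
    by_cases h : y ∈ L
    · obtain ⟨u, hu, rfl⟩ := (hL y).1 h
      exact ⟨u, hu, rfl⟩
    · rw [if_neg h, add_zero] at hy
      obtain ⟨v, hv, h⟩ := shi y hy
      exact ⟨v, hV v hv, h⟩
  · rw [cnotWord_lo, elo u hu]
  · rw [cnotWord_hi, if_pos (mL u (hV u hu)), elo u (hV u hu), ehi u hu, add_comm]
  · rw [cnotWord_hi, if_pos (mL u hu), elo u hu]
    have h0 : k (p.symm (hi (M u))) = 0 := by
      by_contra h
      obtain ⟨v, hv', h⟩ := shi _ h
      exact hv (hM u v hu (hV v hv') h ▸ hv')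
    rw [h0, zero_add]

/-- On words supported on the message qubits, the amplitudes of `U` are those of an encoder
of `QRM(r, m)`. -/
def Encodes (r m : ℕ) (U : Op (Pt m)) : Prop :=
  ∃ c : ℝ, 0 < c ∧ ∀ b b' : Word (Pt m), SupportedOn (IsMessage r m) (monoQubit r m) b →
    U b' b = if ∀ a, m ≤ r + wt a → coef b' a = if wt a ≤ r then b (monoQubit r m a) else 0
      then (c : ℂ) else 0

theorem add_eq_iff_of_eq {x y A B : ZMod 2} (h : x = A) : y = A + B ↔ x + y = B := by
  revert x y A B
  decide

theorem ite_mul_ite_const {P Q : Prop} [Decidable P] [Decidable Q] (x y : ℂ) :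
    ((if P then x else 0) * if Q then y else 0) = if P ∧ Q then x * y else 0 := by
  by_cases hP : P <;> by_cases hQ : Q <;> simp [hP, hQ]

theorem cnotGate_row_list_prod {r m : ℕ} (L : List (Word (Pt m)))
    (hL : (L.map (rowQubit r m)).Nodup) :
    (L.map fun u => cnotGate (lo (rowQubit r m u)) (hi (rowQubit r m u))).prod =
      wordGate (cnotWord (L.map (rowQubit r m))) := by
  rw [← cnotGate_list_prod _ hL, List.map_map]
  rfl

theorem IsBasisEncoder.apply {m : ℕ} {U : Op (Pt m)} (h : IsBasisEncoder m U) :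
    ∀ b b' : Word (Pt m), SupportedOn (fun _ => True) (monoQubit m m) b →
      U b' b = if ∀ a, coef b' a = b (monoQubit m m a) then 1 else 0 := by
  induction h with
  | zero =>
    intro b b' _
    rw [Matrix.one_apply]
    refine if_congr ?_ rfl rfl
    have h : ∀ a : Pt 0, coef b' a = b' a := by
      intro a
      change ∑ x, mono x a * b' x = b' a
      rw [Fintype.sum_subsingleton _ a]
      simp [mono]
    rw [funext_iff]
    refine forall_congr' fun a => ?_
    rw [h, Subsingleton.elim (monoQubit 0 0 a) a]
  | succ m U hU p hlo hhi ih =>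
    intro b b' hb
    have hmem : ∀ u : Pt m, mono u ∈ genRows m m := fun u => by
      rw [mono_mem_genRows]; exact_mod_cast wt_le u
    have hinj : ∀ u v : Pt m, monoQubit m m u = monoQubit m m v → u = v := fun u v =>
      monoQubit_inj le_rfl (by omega) ⟨by omega, wt_le u⟩ ⟨by omega, wt_le v⟩
    rw [cnotGate_row_list_prod, Matrix.mul_assoc, permGate_eq, wordGate_mul, mul_wordGate_apply]
    · obtain ⟨h1, h2, h3, h4, -⟩ := cnotWord_perm (G := fun _ => True) (V := fun _ => True)
        (M' := monoQubit (m + 1) (m + 1)) (M := monoQubit m m) (p := p)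
        (L := (genRows m m).map (rowQubit m m)) (k := b)
        (fun x => by
          simp only [List.mem_map, true_and]
          constructor
          · rintro ⟨g, hg, rfl⟩
            obtain ⟨a, -, rfl⟩ := mem_genRows.1 hg
            exact ⟨a, rfl⟩
          · rintro ⟨u, rfl⟩
            exact ⟨mono u, hmem u, rfl⟩)
        (fun u _ => by rw [monoQubit, mono_lo]; exact hlo _ (hmem u))
        (fun v _ => by rw [monoQubit, mono_hi]; exact hhi _ (hmem v))
        (fun _ _ => trivial) (fun u v _ _ => hinj u v) rfl
        (fun x hx => by
          obtain ⟨a, -, rfl⟩ := hb x hx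
          rcases lo_or_hi a with ⟨u, rfl⟩ | ⟨u, rfl⟩
          · exact Or.inl ⟨u, trivial, rfl⟩
          · exact Or.inr ⟨u, trivial, rfl⟩)
      rw [doubled, Function.comp_apply, ih _ _ h1, ih _ _ h2, ite_mul_ite_const, mul_one]
      refine if_congr ?_ rfl rfl
      simp only [h3 _ trivial, h4 _ trivial, ← coef_lo]
      rw [← forall_and]
      constructor
      · intro h a
        rcases lo_or_hi a with ⟨u, rfl⟩ | ⟨u, rfl⟩
        · exact (h u).1
        · rw [coef_hi, ← coef_lo]
          exact (add_eq_iff_of_eq (h u).1).1 (h u).2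
      · intro h u
        refine ⟨h _, (add_eq_iff_of_eq (h _)).2 ?_⟩
        rw [coef_lo, ← coef_hi]
        exact h _
    · refine List.Nodup.map_on (fun g hg g' hg' h => ?_) (genRows_nodup _ _)
      obtain ⟨u, -, rfl⟩ := mem_genRows.1 hg
      obtain ⟨v, -, rfl⟩ := mem_genRows.1 hg'
      rw [hinj u v h]

theorem IsEncoder.bounds {r m : ℕ} {U : Op (Pt m)} (h : IsEncoder r m U) :
    r ≤ m ∧ m ≤ 2 * r + 1 := by
  induction h with
  | basis U hU => omega
  | step m hm U hU p hlo hhi ih => omega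

/-- The exponent vectors of the rows used by the index map of `QRM(r, m + 1)`. -/
def IsUsed (r m : ℕ) (a : Pt (m + 1)) : Prop :=
  IsMessage r (m + 1) a ∨ ∃ u, wt u + r = m ∧ a = lo u

theorem IsUsed.inj {r m : ℕ} (h1 : r ≤ m) (h2 : m + 1 ≤ 2 * r + 1) {a b : Pt (m + 1)}
    (ha : IsUsed r m a) (hb : IsUsed r m b)
    (h : monoQubit r (m + 1) a = monoQubit r (m + 1) b) : a = b := by
  have hmem : ∀ a, IsUsed r m a → mono a ∈ encRows r (m + 1) := by
    rintro a (ha | ⟨u, hu, rfl⟩)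
    · exact mono_mem_encRows (by omega) ha
    · rw [encRows, if_neg (by omega), mono_lo]
      refine List.mem_append_right _ (List.mem_map_of_mem (mono_mem_rowsDiff.2 ?_))
      omega
  exact mono_injective (rowQubit_inj h2 (hmem a ha) (hmem b hb) h)

theorem Encodes.step {r m : ℕ} (hrm : r ≤ m) (hm : m + 1 ≤ 2 * r + 1) {U : Op (Pt m)}
    (hU : Encodes r m U) (p : Equiv.Perm (Pt (m + 1)))
    (hlo : ∀ u ∈ rowsDiff (genRows m r) (genRows m ((m : ℤ) - r - 1)),
      p (rowQubit r (m + 1) (pair u u)) = lo (rowQubit r m u))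
    (hhi : ∀ v ∈ rowsDiff (genRows m ((r : ℤ) - 1)) (genRows m ((m : ℤ) - r - 1)),
      p (rowQubit r (m + 1) (pair 0 v)) = hi (rowQubit r m v)) :
    Encodes r (m + 1) (doubled U *
      ((rowsDiff (genRows m r) (genRows m ((m : ℤ) - r - 1))).map fun u =>
        cnotGate (lo (rowQubit r m u)) (hi (rowQubit r m u))).prod *
      permGate p *
      ((rowsDiff (genRows m ((m : ℤ) - r)) (genRows m ((m : ℤ) - r - 1))).map fun u =>
        hadamardGate (rowQubit r (m + 1) (pair u u))).prod) := by
  obtain ⟨c, hc, hU⟩ := hU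
  set A := (rowsDiff (genRows m ((m : ℤ) - r)) (genRows m ((m : ℤ) - r - 1))).map fun u =>
    rowQubit r (m + 1) (pair u u) with hA
  have memA : ∀ x, x ∈ A ↔ ∃ u, wt u + r = m ∧ monoQubit r (m + 1) (lo u) = x := by
    intro x
    simp only [hA, List.mem_map, mem_rowsDiff_genRows]
    constructor
    · rintro ⟨_, ⟨u, hu, rfl⟩, rfl⟩
      exact ⟨u, by omega, by rw [monoQubit, mono_lo]⟩
    · rintro ⟨u, hu, rfl⟩
      exact ⟨_, ⟨u, by omega, rfl⟩, by rw [monoQubit, mono_lo]⟩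
  have nodupA : A.Nodup := by
    refine List.Nodup.map_on (fun g hg g' hg' h => ?_) ((genRows_nodup _ _).filter _)
    obtain ⟨u, hu, rfl⟩ := mem_rowsDiff_genRows.1 hg
    obtain ⟨v, hv, rfl⟩ := mem_rowsDiff_genRows.1 hg'
    rw [← mono_lo, ← mono_lo] at h
    rw [lo_injective (IsUsed.inj hrm hm (Or.inr ⟨u, by omega, rfl⟩)
      (Or.inr ⟨v, by omega, rfl⟩) h)]
  have nodupG : ((rowsDiff (genRows m r) (genRows m ((m : ℤ) - r - 1))).map
      (rowQubit r m)).Nodup := by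
    refine List.Nodup.map_on (fun g hg g' hg' h => ?_) ((genRows_nodup _ _).filter _)
    obtain ⟨u, hu, rfl⟩ := mem_rowsDiff_genRows.1 hg
    obtain ⟨v, hv, rfl⟩ := mem_rowsDiff_genRows.1 hg'
    rw [monoQubit_inj hrm (by omega) ⟨by omega, by omega⟩ ⟨by omega, by omega⟩ h]
  have notMemA : ∀ a, IsMessage r (m + 1) a → monoQubit r (m + 1) a ∉ A := by
    intro a ha h
    obtain ⟨u, hu, h⟩ := (memA _).1 h
    rw [← IsUsed.inj hrm hm (Or.inr ⟨u, hu, rfl⟩) (Or.inl ha) h, IsMessage, wt_lo] at ha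
    omega
  have hH : ((rowsDiff (genRows m ((m : ℤ) - r)) (genRows m ((m : ℤ) - r - 1))).map fun u =>
      hadamardGate (rowQubit r (m + 1) (pair u u))) = A.map hadamardGate := by
    rw [hA, List.map_map]; rfl
  refine ⟨c * c * (1 / Real.sqrt 2) ^ A.length, by positivity, fun b b' hb => ?_⟩
  have hbA : ∀ i ∈ A, b i = 0 := by
    intro i hi
    by_contra h
    obtain ⟨a, ha, rfl⟩ := hb i h
    exact notMemA a ha hi
  rw [cnotGate_row_list_prod _ nodupG, Matrix.mul_assoc (doubled U), permGate_eq, wordGate_mul,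
    hH, Matrix.mul_apply]
  simp only [hadamardGate_list_prod A nodupA _ b hbA, mul_wordGate_apply]
  let Q : Word (Pt (m + 1)) → Prop := fun k => ∀ u, m ≤ r + wt u →
    coef b' (lo u) = (if wt u ≤ r then k (monoQubit r (m + 1) (lo u)) else 0) ∧
    coef b' (hi u) = if wt u + 1 ≤ r then k (monoQubit r (m + 1) (hi u)) else 0
  let k₀ : Word (Pt (m + 1)) := fun x =>
    if h : ∃ u, wt u + r = m ∧ monoQubit r (m + 1) (lo u) = x then coef b' (lo h.choose) else b x
  have k₀_mem : ∀ u, wt u + r = m → k₀ (monoQubit r (m + 1) (lo u)) = coef b' (lo u) := by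
    intro u hu
    have h : ∃ v, wt v + r = m ∧ monoQubit r (m + 1) (lo v) = monoQubit r (m + 1) (lo u) :=
      ⟨u, hu, rfl⟩
    simp only [k₀]
    rw [dif_pos h, IsUsed.inj hrm hm (Or.inr ⟨_, h.choose_spec.1, rfl⟩) (Or.inr ⟨u, hu, rfl⟩)
      h.choose_spec.2]
  have k₀_notMem : ∀ x, x ∉ A → k₀ x = b x := fun x hx => dif_neg fun h => hx ((memA x).2 h)
  have key : ∀ k, (∀ j, j ∉ A → k j = b j) →
      doubled U b' ((cnotWord ((rowsDiff (genRows m r) (genRows m ((m : ℤ) - r - 1))).map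
        (rowQubit r m)) ∘ fun b i => b (p.symm i)) k) = if Q k then (c * c : ℂ) else 0 := by
    intro k hk
    obtain ⟨h1, h2, h3, h4, h5⟩ := cnotWord_perm (G := IsMessage r m)
      (V := fun v => IsMessage r m v ∧ wt v + 1 ≤ r)
      (M' := monoQubit r (m + 1)) (M := monoQubit r m) (p := p)
      (L := (rowsDiff (genRows m r) (genRows m ((m : ℤ) - r - 1))).map (rowQubit r m)) (k := k)
      (fun x => by
        simp only [List.mem_map, mem_rowsDiff_genRows, IsMessage]
        constructor
        · rintro ⟨_, ⟨a, ha, rfl⟩, rfl⟩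
          exact ⟨a, by omega, rfl⟩
        · rintro ⟨u, hu, rfl⟩
          exact ⟨mono u, ⟨u, by omega, rfl⟩, rfl⟩)
      (fun u hu => by
        rw [IsMessage] at hu
        rw [monoQubit, mono_lo]
        exact hlo _ (mono_mem_rowsDiff.2 (by omega)))
      (fun v hv => by
        rw [IsMessage] at hv
        rw [monoQubit, mono_hi]
        exact hhi _ (mono_mem_rowsDiff.2 (by omega)))
      (fun _ h => h.1) (fun u v hu hv h => monoQubit_inj hrm (by omega) hu hv h) rfl
      (fun x hx => by
        by_cases hxA : x ∈ A
        · obtain ⟨u, hu, rfl⟩ := (memA x).1 hxA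
          exact Or.inl ⟨u, ⟨by omega, by omega⟩, rfl⟩
        · rw [hk x hxA] at hx
          obtain ⟨a, ha, rfl⟩ := hb x hx
          rcases lo_or_hi a with ⟨u, rfl⟩ | ⟨u, rfl⟩
          · rw [IsMessage, wt_lo] at ha
            exact Or.inl ⟨u, ⟨by omega, by omega⟩, rfl⟩
          · rw [IsMessage, wt_hi] at ha
            exact Or.inr ⟨u, ⟨⟨by omega, by omega⟩, by omega⟩, rfl⟩)
    rw [doubled, Function.comp_apply, hU _ _ h1, hU _ _ h2, ite_mul_ite_const]
    refine if_congr ?_ rfl rfl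
    rw [← forall_and]
    refine forall_congr' fun u => ?_
    rw [← forall_and]
    refine forall_congr' fun hu => ?_
    rw [← coef_lo, coef_hi, ← coef_lo]
    by_cases hr : wt u ≤ r
    · rw [if_pos hr, if_pos hr, if_pos hr, h3 u ⟨hu, hr⟩]
      refine and_congr_right fun h => ?_
      by_cases hr' : wt u + 1 ≤ r
      · rw [if_pos hr', h4 u ⟨⟨hu, hr⟩, hr'⟩, add_eq_iff_of_eq h]
      · rw [if_neg hr', h5 u ⟨hu, hr⟩ fun h => hr' h.2, ← add_eq_iff_of_eq h, add_zero]
    · rw [if_neg hr, if_neg hr, if_neg hr, if_neg (by omega)]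
      refine and_congr_right fun h => ?_
      rw [← add_eq_iff_of_eq h, add_zero]
  have hQ : ∀ k, ((∀ j, j ∉ A → k j = b j) ∧ Q k) ↔ k = k₀ ∧ ∀ a, m + 1 ≤ r + wt a →
      coef b' a = if wt a ≤ r then b (monoQubit r (m + 1) a) else 0 := by
    intro k
    constructor
    · rintro ⟨hk, hQ⟩
      refine ⟨?_, fun a ha => ?_⟩
      · funext x
        by_cases hx : x ∈ A
        · obtain ⟨u, hu, rfl⟩ := (memA x).1 hx
          rw [k₀_mem u hu, (hQ u (by omega)).1, if_pos (by omega)]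
        · rw [hk x hx, k₀_notMem x hx]
      · rcases lo_or_hi a with ⟨u, rfl⟩ | ⟨u, rfl⟩
        · rw [wt_lo] at ha ⊢
          rw [(hQ u (by omega)).1]
          split_ifs with h
          · exact hk _ (notMemA _ ⟨by rwa [wt_lo], by rwa [wt_lo]⟩)
          · rfl
        · rw [wt_hi] at ha ⊢
          rw [(hQ u (by omega)).2]
          split_ifs with h
          · exact hk _ (notMemA _ ⟨by rwa [wt_hi], by rwa [wt_hi]⟩)
          · rfl
    · rintro ⟨rfl, h⟩
      refine ⟨k₀_notMem, fun u hu => ⟨?_, ?_⟩⟩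
      · by_cases hu' : wt u + r = m
        · rw [k₀_mem u hu', if_pos (by omega)]
        · rw [h _ (by rw [wt_lo]; omega), wt_lo]
          split_ifs with hr
          · exact (k₀_notMem _ (notMemA _ ⟨by rw [wt_lo]; omega, by rwa [wt_lo]⟩)).symm
          · rfl
      · rw [h _ (by rw [wt_hi]; omega), wt_hi]
        split_ifs with hr
        · exact (k₀_notMem _ (notMemA _ ⟨by rw [wt_hi]; omega, by rwa [wt_hi]⟩)).symm
        · rfl
  rw [Finset.sum_eq_single k₀]
  · rw [if_pos k₀_notMem, key k₀ k₀_notMem]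
    have := hQ k₀
    simp only [true_and] at this
    rw [ite_mul, zero_mul]
    refine if_congr ((and_iff_right k₀_notMem).symm.trans this) ?_ rfl
    push_cast
    rfl
  · intro k _ hk
    by_cases h : ∀ j, j ∉ A → k j = b j
    · rw [key k h, if_neg fun hq => hk ((hQ k).1 ⟨h, hq⟩).1, zero_mul]
    · rw [if_neg h, mul_zero]
  · simp

theorem IsEncoder.encodes {r m : ℕ} {U : Op (Pt m)} (h : IsEncoder r m U) : Encodes r m U := by
  induction h with
  | basis U hU =>
    refine ⟨1, one_pos, fun b b' hb => ?_⟩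
    rw [hU.apply b b' fun x hx => (hb x hx).imp fun a ha => ⟨trivial, ha.2⟩, Complex.ofReal_one]
    refine if_congr (forall_congr' fun a => ?_) rfl rfl
    rw [if_pos (wt_le a), imp_iff_right (by omega)]
  | step m hm U hU p hlo hhi ih => exact ih.step hU.bounds.1 hm p hlo hhi

/-! ### Splitting off GHZ states -/

section Factor

set_option linter.unusedSectionVars false

variable {ι κ : Type*} [Fintype ι] [DecidableEq ι] [Fintype κ] [DecidableEq κ]

theorem ghz_apply [Nonempty κ] (b : Word κ) :
    ghz b = if ∃ z, ∀ t, b t = z then ((1 / Real.sqrt 2 : ℝ) : ℂ) else 0 := by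
  have hz : ∀ z : ZMod 2, z = 0 ∨ z = 1 := by decide
  have h0 : (0 : Word κ) ≠ 1 := fun h => by
    simpa using congrFun h (Classical.arbitrary κ)
  simp only [ghz, Pi.smul_apply, Pi.add_apply, ket, smul_eq_mul]
  by_cases hb0 : b = 0
  · subst hb0
    rw [if_pos rfl, if_neg h0, if_pos ⟨0, fun _ => rfl⟩, add_zero, mul_one]
  · by_cases hb1 : b = 1
    · subst hb1
      rw [if_pos rfl, if_neg hb0, if_pos ⟨1, fun _ => rfl⟩, zero_add, mul_one]
    · rw [if_neg hb0, if_neg hb1, if_neg, add_zero, mul_zero]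
      rintro ⟨z, h⟩
      rcases hz z with rfl | rfl
      · exact hb0 (funext h)
      · exact hb1 (funext h)

variable {N : ℕ} (q : Fin N → κ → ι)

/-- The word with the bit `z j` on the qubits `q j t` and with the bits of `d` elsewhere. -/
noncomputable def glue (z : Fin N → ZMod 2) (d : Word {x : ι // ∀ j t, q j t ≠ x}) : Word ι :=
  fun x => if h : ∃ j t, q j t = x then z h.choose else d ⟨x, fun j t e => h ⟨j, t, e⟩⟩

variable {q}

theorem glue_mem (hq : Function.Injective (Function.uncurry q)) (z : Fin N → ZMod 2)
    (d : Word {x : ι // ∀ j t, q j t ≠ x}) (j : Fin N) (t : κ) : glue q z d (q j t) = z j := by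
  have h : ∃ j' t', q j' t' = q j t := ⟨j, t, rfl⟩
  obtain ⟨t', ht'⟩ := h.choose_spec
  rw [glue, dif_pos h]
  exact congrArg z (Prod.ext_iff.1 (hq (a₁ := (_, t')) (a₂ := (j, t)) ht')).1

theorem glue_rest (z : Fin N → ZMod 2) (d : Word {x : ι // ∀ j t, q j t ≠ x})
    (x : {x : ι // ∀ j t, q j t ≠ x}) : glue q z d x = d x :=
  dif_neg fun ⟨j, t, h⟩ => x.2 j t h

theorem eq_glue (hq : Function.Injective (Function.uncurry q)) {b : Word ι} {z : Fin N → ZMod 2}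
    (h : ∀ j t, b (q j t) = z j) : b = glue q z fun x => b x := by
  funext x
  by_cases hx : ∃ j t, q j t = x
  · obtain ⟨j, t, rfl⟩ := hx
    rw [glue_mem hq, h]
  · exact (glue_rest z (fun x => b x) ⟨x, fun j t e => hx ⟨j, t, e⟩⟩).symm

theorem glue_injective [Nonempty κ] (hq : Function.Injective (Function.uncurry q)) :
    Function.Injective fun p : (Fin N → ZMod 2) × Word {x : ι // ∀ j t, q j t ≠ x} =>
      glue q p.1 p.2 := by
  rintro ⟨z, d⟩ ⟨z', d'⟩ h
  refine Prod.ext ?_ ?_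
  · funext j
    have := congrFun h (q j (Classical.arbitrary κ))
    simpa only [glue_mem hq] using this
  · funext x
    have := congrFun h x
    simpa only [glue_rest] using this

theorem glue_eq_add (hq : Function.Injective (Function.uncurry q)) (z : Fin N → ZMod 2)
    (d : Word {x : ι // ∀ j t, q j t ≠ x}) :
    glue q z d = glue q 0 d + ∑ j, z j • fun x => if ∃ t, q j t = x then (1 : ZMod 2) else 0 := by
  refine ((eq_glue hq (z := z) fun j t => ?_).trans ?_).symm
  · rw [Pi.add_apply, glue_mem hq, Finset.sum_apply, Finset.sum_eq_single j]
    · simp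
    · intro j' _ hj'
      rw [Pi.smul_apply, if_neg, smul_zero]
      rintro ⟨t', h⟩
      exact hj' (Prod.ext_iff.1 (hq (a₁ := (j', t')) (a₂ := (j, t)) h)).1
    · simp
  · congr 1
    funext x
    rw [Pi.add_apply, glue_rest, Finset.sum_apply, Finset.sum_eq_zero, add_zero]
    intro j _
    rw [Pi.smul_apply, if_neg fun ⟨t, h⟩ => x.2 j t h, smul_zero]

/-- A uniform superposition of the words of an additive code in which the bits on the qubits
`q j t` agree for fixed `j`, and can be flipped simultaneously, contains GHZ states. -/
theorem exists_factorsAs_ghz [Nonempty κ] (hq : Function.Injective (Function.uncurry q))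
    (D : AddSubgroup (Word ι)) (hD : ∀ b ∈ D, ∀ j, ∃ z, ∀ t, b (q j t) = z)
    (hflip : ∀ j, (fun x => if ∃ t, q j t = x then (1 : ZMod 2) else 0) ∈ D)
    {ψ : State ι} (hψ : IsUnitState ψ) {c : ℝ} (hc : 0 < c)
    (hψD : ∀ b, (b ∈ D → ψ b = c) ∧ (b ∉ D → ψ b = 0)) :
    ∃ φ : State {x : ι // ∀ j t, q j t ≠ x}, IsUnitState φ ∧ FactorsAs ψ q ghz φ ∧
      ((∀ b ∈ D, (∀ j t, b (q j t) = 0) → b = 0) → φ = ket 0) := by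
  classical
  have hglue : ∀ z d, glue q z d ∈ D ↔ glue q 0 d ∈ D := by
    intro z d
    rw [glue_eq_add hq z d]
    refine AddSubgroup.add_mem_cancel_right _ (AddSubgroup.sum_mem _ fun j _ => ?_)
    have hz : ∀ z : ZMod 2, z = 0 ∨ z = 1 := by decide
    rcases hz (z j) with h | h
    · rw [h, zero_smul]; exact D.zero_mem
    · rw [h, one_smul]; exact hflip j
  let C : ℝ := c * Real.sqrt 2 ^ N
  have hC : 0 < C := by positivity
  have hC2 : C ^ 2 = 2 ^ N * c ^ 2 := by
    simp only [C]
    rw [mul_pow, ← pow_mul, mul_comm N, pow_mul, Real.sq_sqrt (by norm_num), mul_comm]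
  let φ : State {x : ι // ∀ j t, q j t ≠ x} := fun d => if glue q 0 d ∈ D then (C : ℂ) else 0
  have hunit : IsUnitState φ := by
    rw [IsUnitState] at hψ ⊢
    rw [← hψ]
    rw [← Finset.sum_of_injOn (s := Finset.univ)
      (f := fun p : (Fin N → ZMod 2) × Word {x : ι // ∀ j t, q j t ≠ x} =>
        ‖ψ (glue q p.1 p.2)‖ ^ 2)
      (fun p => glue q p.1 p.2) (glue_injective hq).injOn (by simp) ?_ fun _ _ => rfl]
    · rw [Fintype.sum_prod_type, Finset.sum_comm]
      refine Finset.sum_congr rfl fun d _ => ?_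
      by_cases hd : glue q 0 d ∈ D
      · have h1 : ∀ z, ψ (glue q z d) = c := fun z => (hψD _).1 ((hglue z d).2 hd)
        simp only [φ, h1, if_pos hd, Complex.norm_real, Real.norm_eq_abs, sq_abs, hC2]
        simp
      · have h1 : ∀ z, ψ (glue q z d) = 0 := fun z => (hψD _).2 fun h => hd ((hglue z d).1 h)
        simp [φ, h1, if_neg hd]
    · intro b _ hb
      rw [(hψD b).2, norm_zero, zero_pow two_ne_zero]
      intro hbD
      choose z hz using hD b hbD
      exact hb ⟨(z, fun x => b x), by simp, (eq_glue hq hz).symm⟩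
  refine ⟨φ, hunit, fun b => ?_, fun h0 => ?_⟩
  · simp only [ghz_apply]
    by_cases hz : ∀ j, ∃ z, ∀ t, b (q j t) = z
    · rw [Finset.prod_congr rfl fun j _ => if_pos (hz j), Finset.prod_const, Finset.card_univ,
        Fintype.card_fin]
      choose z hz using hz
      have hb : glue q 0 (fun x => b x) ∈ D ↔ b ∈ D := by
        rw [← hglue z, ← eq_glue hq hz]
      by_cases hbD : b ∈ D
      · simp only [φ]
        rw [(hψD b).1 hbD, if_pos (hb.2 hbD), ← Complex.ofReal_pow, ← Complex.ofReal_mul]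
        congr 1
        have : Real.sqrt 2 ≠ 0 := by positivity
        simp only [C]
        rw [one_div, inv_pow, mul_left_comm, inv_mul_cancel₀ (pow_ne_zero N this), mul_one]
      · simp only [φ]
        rw [(hψD b).2 hbD, if_neg fun h => hbD (hb.1 h), mul_zero]
    · rw [(hψD b).2 fun h => hz (hD b h)]
      push Not at hz
      obtain ⟨j, hj⟩ := hz
      rw [Finset.prod_eq_zero (Finset.mem_univ j), zero_mul]
      refine if_neg ?_
      push Not
      exact hj
  · have hd : ∀ d, glue q 0 d ∈ D ↔ d = 0 := by
      intro d
      constructor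
      · intro h
        have := h0 _ h fun j t => glue_mem hq _ _ _ _
        funext x
        rw [← glue_rest 0 d x, this]
        rfl
      · rintro rfl
        convert D.zero_mem
        exact (eq_glue hq (b := 0) (z := 0) fun _ _ => rfl).symm
    have hφ : ∀ d, φ d = if d = 0 then (C : ℂ) else 0 := fun d => if_congr (hd d) rfl rfl
    have hC1 : C = 1 := by
      rw [IsUnitState, Finset.sum_eq_single 0 (fun d _ h => by simp [hφ, h]) (by simp)] at hunit
      rw [hφ, if_pos rfl, Complex.norm_real, Real.norm_eq_abs, sq_abs] at hunit
      nlinarith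
    funext d
    rw [hφ, hC1, ket, Complex.ofReal_one]

theorem isUnitState_iff (ψ : State ι) : IsUnitState ψ ↔ star ψ ⬝ᵥ ψ = 1 := by
  have h : star ψ ⬝ᵥ ψ = ((∑ b, ‖ψ b‖ ^ 2 : ℝ) : ℂ) := by
    simp [dotProduct, Complex.conj_mul']
  rw [h, IsUnitState]
  norm_cast

theorem IsUnitState.mulVec {ψ : State ι} (hψ : IsUnitState ψ) {A : Op ι} (hA : Aᴴ * A = 1) :
    IsUnitState (A *ᵥ ψ) := by
  rw [isUnitState_iff] at hψ ⊢
  rw [Matrix.star_mulVec, ← Matrix.dotProduct_mulVec, Matrix.mulVec_mulVec, hA,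
    Matrix.one_mulVec, hψ]

end Factor

/-! ### Decoding the blocks -/

theorem codeword_zero_apply (r m : ℕ) (b : Word (Pt m)) :
    codeword r m 0 b =
      if b ∈ RMdual r m then ((1 / Real.sqrt ((RMdual r m).card : ℝ) : ℝ) : ℂ) else 0 := by
  simp [codeword, ket, Finset.sum_apply]

theorem card_RMdual_pos (r m : ℕ) : 0 < (RMdual r m).card :=
  Finset.card_pos.2 ⟨0, mem_RMdual.2 fun a _ => by rw [coef_zero]; rfl⟩

theorem isUnitState_codeword_zero (r m : ℕ) : IsUnitState (codeword r m 0) := by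
  have h : (0 : ℝ) < (RMdual r m).card := by exact_mod_cast card_RMdual_pos r m
  have h1 : ∀ b, ‖codeword r m 0 b‖ ^ 2 =
      if b ∈ RMdual r m then 1 / ((RMdual r m).card : ℝ) else 0 := by
    intro b
    rw [codeword_zero_apply]
    split_ifs
    · rw [Complex.norm_real, Real.norm_eq_abs, sq_abs, div_pow, one_pow, Real.sq_sqrt h.le]
    · simp
  rw [IsUnitState]
  simp only [h1, Finset.sum_ite_mem, Finset.univ_inter, Finset.sum_const, nsmul_eq_mul]
  field_simp

section Decode

variable {l m : ℕ} (r : ℕ) (s : Fin l ↪ Fin m)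

/-- The words on the message qubits of the blocks that encode the blocks of `c`. -/
def IsDecoding (b c : Word (Pt m)) : Prop := ∀ t,
  SupportedOn (IsMessage r (m - l)) (monoQubit r (m - l)) (blockWords s b t) ∧
  ∀ a, m - l ≤ r + wt a → coef (blockWords s c t) a =
    if wt a ≤ r then blockWords s b t (monoQubit r (m - l) a) else 0

/-- The words in the decoded state. -/
def decodedWords : AddSubgroup (Word (Pt m)) where
  carrier := {b | ∃ c ∈ RMdual r m, IsDecoding r s b c}
  zero_mem' := by
    refine ⟨0, mem_RMdual.2 fun a _ => by rw [coef_zero]; rfl, fun t => ⟨fun x hx => ?_, ?_⟩⟩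
    · exact absurd rfl hx
    · intro a _
      change coef 0 a = if _ then 0 else 0
      rw [coef_zero]
      simp
  add_mem' := by
    rintro b b' ⟨c, hc, h⟩ ⟨c', hc', h'⟩
    rw [mem_RMdual] at hc hc'
    refine ⟨c + c', mem_RMdual.2 fun a ha => ?_, fun t => ⟨fun x hx => ?_, fun a ha => ?_⟩⟩
    · rw [coef_add, Pi.add_apply, hc a ha, hc' a ha, add_zero]
    · by_cases hb : blockWords s b t x = 0
      · refine (h' t).1 x fun hb' => hx ?_
        change blockWords s b t x + blockWords s b' t x = 0
        rw [hb, hb', add_zero]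
      · exact (h t).1 x hb
    · change coef (blockWords s c t + blockWords s c' t) a =
        if wt a ≤ r then blockWords s b t _ + blockWords s b' t _ else 0
      rw [coef_add, Pi.add_apply, (h t).2 a ha, (h' t).2 a ha]
      split_ifs <;> simp
  neg_mem' := by
    intro b hb
    have h2 : ∀ z : ZMod 2, -z = z := by decide
    have : -b = b := funext fun x => h2 (b x)
    rwa [this]

variable {r s}

/-- The coefficients of highest degree are the same on all blocks. -/
theorem coef_blockWords_of_mem_RMdual {c : Word (Pt m)} (hc : c ∈ RMdual r m) {y : Pt (m - l)}
    (hy : m ≤ r + wt y + 1) (t : Pt l) :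
    coef (blockWords s c t) y = coef c (blockQubit s 0 y) := by
  rw [coef_blockWords, Finset.sum_eq_single 0]
  · simp [mono]
  · intro t' _ ht'
    have hpos : 0 < wt t' := by
      obtain ⟨i, hi⟩ := Function.ne_iff.1 ht'
      refine Finset.sum_pos' (fun _ _ => Nat.zero_le _) ⟨i, Finset.mem_univ _, ?_⟩
      exact Nat.pos_of_ne_zero fun h => hi ((ZMod.val_eq_zero _).1 h)
    rw [mem_RMdual.1 hc _ (by rw [wt_blockQubit]; omega), mul_zero]
  · simp

theorem coef_blockWords_eq_zero {c : Word (Pt m)} (hc : c ∈ RMdual r m) {y : Pt (m - l)}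
    (hy : m ≤ r + wt y) (t : Pt l) : coef (blockWords s c t) y = 0 := by
  rw [coef_blockWords_of_mem_RMdual hc (by omega), mem_RMdual.1 hc _ (by rw [wt_blockQubit]; omega)]

theorem exists_isDecoding (hr : m ≤ 2 * r + 1) (hlm : l + r ≤ m) {c : Word (Pt m)}
    (hc : c ∈ RMdual r m) : ∃ b, IsDecoding r s b c := by
  classical
  let b : Pt l → Word (Pt (m - l)) := fun t x =>
    if h : ∃ a, IsMessage r (m - l) a ∧ x = monoQubit r (m - l) a
      then coef (blockWords s c t) h.choose else 0
  refine ⟨(blockWords s).symm b, fun t => ?_⟩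
  rw [Equiv.apply_symm_apply]
  refine ⟨fun x hx => ?_, fun a ha => ?_⟩
  · by_contra h
    exact hx (dif_neg h)
  · split_ifs with har
    · have h : ∃ a', IsMessage r (m - l) a' ∧ monoQubit r (m - l) a = monoQubit r (m - l) a' :=
        ⟨a, ⟨ha, har⟩, rfl⟩
      simp only [b]
      rw [dif_pos h, ← monoQubit_inj (by omega) (by omega) ⟨ha, har⟩ h.choose_spec.1
        h.choose_spec.2]
    · exact coef_blockWords_eq_zero hc (by omega) t

theorem IsDecoding.unique {b b' c : Word (Pt m)} (h : IsDecoding r s b c)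
    (h' : IsDecoding r s b' c) : b = b' := by
  apply (blockWords s).injective
  funext t x
  by_cases hx : ∃ a, IsMessage r (m - l) a ∧ x = monoQubit r (m - l) a
  · obtain ⟨a, ha, rfl⟩ := hx
    have h1 := (h t).2 a ha.1
    have h2 := (h' t).2 a ha.1
    rw [if_pos ha.2] at h1 h2
    rw [← h1, h2]
  · have hb : blockWords s b t x = 0 := by
      by_contra hne
      exact hx ((h t).1 x hne)
    have hb' : blockWords s b' t x = 0 := by
      by_contra hne
      exact hx ((h' t).1 x hne)
    rw [hb, hb']

theorem IsDecoding.mem_RMdual {b c : Word (Pt m)} (h : IsDecoding r s b c)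
    (hb : b ∈ decodedWords r s) : c ∈ RMdual r m := by
  obtain ⟨c', hc', h'⟩ := hb
  refine QRM.mem_RMdual.2 fun x hx => ?_
  obtain ⟨t, y, rfl⟩ := exists_blockQubit s x
  rw [← QRM.mem_RMdual.1 hc' _ hx, coef_blockQubit, coef_blockQubit]
  rw [wt_blockQubit] at hx
  have := wt_le t
  refine Finset.sum_congr rfl fun t' _ => ?_
  rw [(h t').2 y (by omega), (h' t').2 y (by omega)]

open Classical in
theorem exists_onBlocks_apply {U : Op (Pt (m - l))} (hU : IsEncoder r (m - l) U) :
    ∃ K : ℝ, 0 < K ∧ ∀ b ∈ decodedWords r s, ∀ b',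
      onBlocks s U b' b = if IsDecoding r s b b' then (K : ℂ) else 0 := by
  obtain ⟨c, hc, h⟩ := hU.encodes
  refine ⟨c ^ Fintype.card (Pt l), by positivity, ?_⟩
  rintro b ⟨_, -, hb⟩ b'
  change ∏ t, U (blockWords s b' t) (blockWords s b t) = _
  rw [Finset.prod_congr rfl fun t _ => h _ (blockWords s b' t) (hb t).1]
  by_cases hd : IsDecoding r s b b'
  · rw [if_pos hd, Finset.prod_congr rfl fun t _ => if_pos (hd t).2]
    simp
  · rw [if_neg hd]
    obtain ⟨t, ht⟩ := not_forall.1 hd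
    exact Finset.prod_eq_zero (Finset.mem_univ t) (if_neg fun h => ht ⟨(hb t).1, h⟩)

/-- The decoded state is the uniform superposition of the decoded words. -/
theorem exists_decodeBlocks_apply (hr : m ≤ 2 * r + 1) (hlm : l + r ≤ m) {U : Op (Pt (m - l))}
    (hU : IsEncoder r (m - l) U) : ∃ c : ℝ, 0 < c ∧ ∀ b,
      (b ∈ decodedWords r s → decodeBlocks s U (codeword r m 0) b = c) ∧
      (b ∉ decodedWords r s → decodeBlocks s U (codeword r m 0) b = 0) := by
  classical
  obtain ⟨K, hK, hW⟩ := exists_onBlocks_apply (s := s) hU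
  let χ : State (Pt m) := fun b => if b ∈ decodedWords r s then 1 else 0
  have hχ : onBlocks s U *ᵥ χ = fun b' => if b' ∈ RMdual r m then (K : ℂ) else 0 := by
    funext b'
    have hterm : ∀ b, onBlocks s U b' b * χ b =
        if b ∈ decodedWords r s ∧ IsDecoding r s b b' then (K : ℂ) else 0 := by
      intro b
      by_cases hb : b ∈ decodedWords r s
      · simp [χ, hb, hW b hb b']
      · simp [χ, hb]
    simp only [Matrix.mulVec, dotProduct, hterm]
    by_cases hb' : b' ∈ RMdual r m
    · obtain ⟨b, hb⟩ := exists_isDecoding (s := s) hr hlm hb'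
      rw [if_pos hb', Finset.sum_eq_single b (fun b₂ _ hne => if_neg fun h => hne (h.2.unique hb))
        (by simp), if_pos ⟨⟨b', hb', hb⟩, hb⟩]
    · rw [if_neg hb']
      exact Finset.sum_eq_zero fun b _ => if_neg fun h => hb' (h.2.mem_RMdual h.1)
  have hcard : (0 : ℝ) < (RMdual r m).card := by exact_mod_cast card_RMdual_pos r m
  let c : ℝ := 1 / Real.sqrt ((RMdual r m).card : ℝ) / K
  have hcode : codeword r m 0 = (c : ℂ) • (onBlocks s U *ᵥ χ) := by
    rw [hχ]
    funext b
    rw [codeword_zero_apply, Pi.smul_apply, smul_eq_mul, mul_ite, mul_zero, ← Complex.ofReal_mul]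
    simp only [c, div_mul_cancel₀ _ hK.ne']
  have hdec : decodeBlocks s U (codeword r m 0) = (c : ℂ) • χ := by
    rw [decodeBlocks, onBlocks_conjTranspose, hcode, Matrix.mulVec_smul, Matrix.mulVec_mulVec,
      onBlocks_isometry s hU.isometry, Matrix.one_mulVec]
  refine ⟨c, by positivity, fun b => ⟨fun hb => ?_, fun hb => ?_⟩⟩ <;>
    simp [hdec, χ, hb]

theorem isUnitState_decodeBlocks {U : Op (Pt (m - l))} (hU : Uᴴ * U = 1) {ψ : State (Pt m)}
    (hψ : IsUnitState ψ) : IsUnitState (decodeBlocks s U ψ) := by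
  rw [decodeBlocks, onBlocks_conjTranspose]
  refine hψ.mulVec ?_
  rw [Matrix.conjTranspose_conjTranspose]
  exact mul_eq_one_comm.1 (onBlocks_isometry s hU)

end Decode

/-! ### The GHZ states -/

theorem card_wt_eq (n d : ℕ) : Fintype.card {y : Pt n // wt y = d} = n.choose d := by
  have hz : ∀ z : ZMod 2, z ≠ 1 → z = 0 := by decide
  let e : Pt n ≃ Finset (Fin n) :=
    { toFun := fun y => Finset.univ.filter fun i => y i = 1
      invFun := fun S i => if i ∈ S then 1 else 0
      left_inv := fun y => by
        funext i
        by_cases h : y i = 1 <;> simp [h, hz]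
      right_inv := fun S => by
        ext i
        simp }
  have he : ∀ y, wt y = (e y).card := by
    intro y
    simp only [e, Equiv.coe_fn_mk, Finset.card_filter, wt]
    refine Finset.sum_congr rfl fun i _ => ?_
    by_cases h : y i = 1
    · simp [h, ZMod.val_one]
    · simp [hz _ h]
  rw [Fintype.card_congr (e.subtypeEquiv (q := fun S => S.card = d) fun y => by rw [he]),
    Fintype.card_finset_len, Fintype.card_fin]

theorem exists_decodeBlocks_factorsAs_ghz {r m l : ℕ} (hr : m ≤ 2 * r + 1) (hl : 1 ≤ l)
    (hlm : l + r ≤ m) (s : Fin l ↪ Fin m) {U : Op (Pt (m - l))} (hU : IsEncoder r (m - l) U)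
    {κ : Type*} [Fintype κ] [DecidableEq κ] (e : κ ≃ Pt l) :
    ∃ (q : Fin ((m - l).choose (m - r - 1)) → κ → Pt m)
      (φ : State {x : Pt m // ∀ j t, q j t ≠ x}),
      Function.Injective (Function.uncurry q) ∧ (∀ j k, q j k ∈ block s (e k)) ∧
      IsUnitState φ ∧ FactorsAs (decodeBlocks s U (codeword r m 0)) q ghz φ ∧
      (l = 1 → φ = ket 0) := by
  let f := (Fintype.equivFinOfCardEq (card_wt_eq (m - l) (m - r - 1))).symm
  have hf : ∀ j, wt (f j).1 = m - r - 1 := fun j => (f j).2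
  have hmsg : ∀ j, IsMessage r (m - l) (f j).1 := fun j => by
    rw [IsMessage, hf]; omega
  let q : Fin ((m - l).choose (m - r - 1)) → κ → Pt m := fun j k =>
    blockQubit s (e k) (monoQubit r (m - l) (f j).1)
  have hminj : ∀ {a b}, IsMessage r (m - l) a → IsMessage r (m - l) b →
      monoQubit r (m - l) a = monoQubit r (m - l) b → a = b :=
    monoQubit_inj (by omega) (by omega)
  have hq : Function.Injective (Function.uncurry q) := by
    rintro ⟨j, k⟩ ⟨j', k'⟩ h
    obtain ⟨h1, h2⟩ := blockQubit_inj s h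
    exact Prod.ext (f.injective (Subtype.ext (hminj (hmsg j) (hmsg j') h2))) (e.injective h1)
  have hval : ∀ b c, IsDecoding r s b c → ∀ j k,
      b (q j k) = coef (blockWords s c (e k)) (f j).1 := by
    intro b c h j k
    rw [(h (e k)).2 _ (hmsg j).1, if_pos (hmsg j).2]
    rfl
  obtain ⟨c, hc, hdec⟩ := exists_decodeBlocks_apply (s := s) hr hlm hU
  have : Nonempty κ := ⟨e.symm 0⟩
  have hconst : ∀ b ∈ decodedWords r s, ∀ j, ∃ z, ∀ k, b (q j k) = z := by
    rintro b ⟨c, hc, h⟩ j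
    refine ⟨coef c (blockQubit s 0 (f j).1), fun k => ?_⟩
    rw [hval b c h, coef_blockWords_of_mem_RMdual hc (by rw [hf]; omega)]
  have hflip : ∀ j,
      (fun x => if ∃ k, q j k = x then (1 : ZMod 2) else 0) ∈ decodedWords r s := by
    intro j
    have hmem : mono (blockQubit s 0 (f j).1) ∈ RMdual r m := by
      refine mem_RMdual.2 fun a ha => ?_
      rw [coef_mono, if_neg]
      rintro rfl
      have h0 : wt (0 : Pt l) = 0 := by simp [wt]
      rw [wt_blockQubit, hf, h0] at ha
      omega
    have hex : ∀ t x, (∃ k, q j k = blockQubit s t x) ↔ x = monoQubit r (m - l) (f j).1 := by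
      intro t x
      constructor
      · rintro ⟨k, hk⟩
        exact (blockQubit_inj s hk).2.symm
      · rintro rfl
        exact ⟨e.symm t, by simp [q]⟩
    have hword : ∀ t x, blockWords s (fun x => if ∃ k, q j k = x then (1 : ZMod 2) else 0) t x =
        if x = monoQubit r (m - l) (f j).1 then 1 else 0 := fun t x =>
      if_congr (hex t x) rfl rfl
    have hmono : ∀ t, blockWords s (mono (blockQubit s 0 (f j).1)) t = mono (f j).1 := by
      intro t
      funext y
      rw [blockWords_apply, mono_blockQubit]
      simp [mono]
    refine ⟨_, hmem, fun t => ⟨fun x hx => ?_, fun a ha => ?_⟩⟩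
    · rw [hword] at hx
      exact ⟨_, hmsg j, by by_contra h; exact hx (if_neg h)⟩
    · rw [hmono, coef_mono, hword]
      by_cases har : wt a ≤ r
      · rw [if_pos har]
        exact if_congr ⟨fun h => h ▸ rfl, fun h => hminj ⟨ha, har⟩ (hmsg j) h⟩ rfl rfl
      · rw [if_neg har, if_neg]
        rintro rfl
        exact har (hmsg j).2
  obtain ⟨φ, hφ, hfac, h0⟩ := exists_factorsAs_ghz hq (decodedWords r s) hconst hflip
    (isUnitState_decodeBlocks hU.isometry (isUnitState_codeword_zero r m)) hc hdec
  refine ⟨q, φ, hq, fun j k a => blockQubit_coord s _ _ a, hφ, hfac, fun hl1 => h0 ?_⟩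
  rintro b ⟨c, hc, h⟩ hb
  apply (blockWords s).injective
  funext t x
  change blockWords s b t x = 0
  by_contra hne
  obtain ⟨a, ha, rfl⟩ := (h t).1 x hne
  have h1 := (h t).2 a ha.1
  rw [if_pos ha.2] at h1
  by_cases hwt : wt a = m - r - 1
  · have h2 := hb (f.symm ⟨a, hwt⟩) (e.symm t)
    simp only [q, Equiv.apply_symm_apply] at h2
    exact hne h2
  · rw [IsMessage] at ha
    rw [← h1] at hne
    exact hne (coef_blockWords_eq_zero hc (by omega) t)

theorem bell_eq_ghz : bell = ghz (ι := Fin 2) := by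
  have h0 : (![0, 0] : Word (Fin 2)) = 0 := by decide
  have h1 : (![1, 1] : Word (Fin 2)) = 1 := by decide
  rw [bell, ghz, h0, h1]

end QRM

theorem mainTheorem10 (r m : ℕ) (hr : m ≤ 2 * r + 1) :
    (∀ (l : ℕ) (_ : 1 ≤ l) (_ : l + r ≤ m) (s : Fin l ↪ Fin m)
        (U : QRM.Op (QRM.Pt (m - l))) (_ : QRM.IsEncoder r (m - l) U),
      ∃ (q : Fin ((m - l).choose (m - r - 1)) → QRM.Pt l → QRM.Pt m)
        (φ : QRM.State {x : QRM.Pt m // ∀ j t, q j t ≠ x}),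
        Function.Injective (Function.uncurry q) ∧
        (∀ j t, q j t ∈ QRM.block s t) ∧
        QRM.IsUnitState φ ∧
        QRM.FactorsAs (QRM.decodeBlocks s U (QRM.codeword r m 0)) q QRM.ghz φ) ∧
    (∀ (_ : r + 1 ≤ m) (s : Fin 1 ↪ Fin m)
        (U : QRM.Op (QRM.Pt (m - 1))) (_ : QRM.IsEncoder r (m - 1) U),
      ∃ q : Fin ((m - 1).choose (m - r - 1)) → Fin 2 → QRM.Pt m,
        Function.Injective (Function.uncurry q) ∧
        (∀ j, q j 0 ∈ QRM.block s ![0] ∧ q j 1 ∈ QRM.block s ![1]) ∧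
        QRM.FactorsAs (QRM.decodeBlocks s U (QRM.codeword r m 0)) q QRM.bell (QRM.ket 0)) := by
  constructor
  · intro l hl hlm s U hU
    obtain ⟨q, φ, hq, hblock, hφ, hfac, -⟩ :=
      QRM.exists_decodeBlocks_factorsAs_ghz hr hl hlm s hU (Equiv.refl _)
    exact ⟨q, φ, hq, hblock, hφ, hfac⟩
  · intro hrm s U hU
    obtain ⟨q, φ, hq, hblock, -, hfac, h0⟩ :=
      QRM.exists_decodeBlocks_factorsAs_ghz hr le_rfl (by omega) s hU
        (κ := Fin 2) (Equiv.funUnique (Fin 1) (ZMod 2)).symm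
    rw [h0 rfl, ← QRM.bell_eq_ghz] at hfac
    refine ⟨q, hq, fun j => ⟨fun a => ?_, fun a => ?_⟩, ?_⟩
    · rw [hblock j 0 a, Subsingleton.elim a 0]
      rfl
    · rw [hblock j 1 a, Subsingleton.elim a 0]
      rfl
    · convert hfac
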